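/- All graphs are finite, undirected and simple. For a graph $G$ and $k\ge 0$, the $k$-core of $G$ is its unique maximal subgraph in which every node has degree at least $k$, and the core-value of a node $v$ is the largest $k$ such that $v$ lies in the $k$-core. Let $n\ge 1$, let $\mathbf c=(c_1\ge c_2\ge\dots\ge c_n)$ be a sequence of non-negative integers, and let $\mathcal S_{\mathbf c}$ be the set of all graphs on the node set $\{1,\dots,n\}$ in which each node $v$ has core-value $c_v$. A move out of $G\in\mathcal S_{\mathbf c}$ deletes some edges of $G$ and inserts some non-edges of $G$; two moves are the same if they delete the same edges and insert the same edges. The legal moves out of $G$ are the following, where $h,i,j,\ell$ denote distinct nodes. 1. *Add / Delete*: insert a non-edge $ij$, or delete an edge $ij$, provided that no core-value changes. 2. *Move Endpoint*: if $c_j<\min(c_h,c_i)$, $hj$ is an edge and $ij$ is not, delete $hj$ and insert $ij$. 3. *Core Collapse / Core Expand*, where $c_h>c_i=c_j$: if $hi,hj$ are edges and $ij$ is not, delete $hi,hj$ and insert $ij$; conversely, if $ij$ is an edge and $hi,hj$ are not, delete $ij$ and insert $hi,hj$; in both cases provided that no core-value changes. *Half-moves*, again with $c_h>c_i=c_j$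 and provided that no core-value changes: if $hi$ is an edge and $ij$ is not, delete $hi$ and insert $ij$; conversely, if $ij$ is an edge and $hi$ is not, delete $ij$ and insert $hi$. 4. Only if $c_1=2$, *top-core switch*: if $c_h=c_i=c_j=c_\ell=c_1$, $hi$ and $j\ell$ are edges and $hj$ and $i\ell$ are not, replace $hi,j\ell$ by $hj,i\ell$, provided that no core-value changes. Assume $c_1\ge 2$ (so that the move set is 1–3 if $c_1>2$ and 1–4 if $c_1=2$). Then: (a) every legal move out of a graph $G\in\mathcal S_{\mathbf c}$ preserves all core-values, that is, it leads to a graph in $\mathcal S_{\mathbf c}$; and if a legal move transforms $G$ into $G'$, then some legal move transforms $G'$ into $G$; (b) the resulting move graph on $\mathcal S_{\mathbf c}$ is connected: for any $G_1,G_2\in\mathcal S_{\mathbf c}$ there is a finite sequence of legal moves that transforms $G_1$ into $G_2$; (c) let $D(G)$ be the number of legal moves out of $G$ and $\Delta=\max_{G\in\mathcal S_{\mathbf c}}D(G)$. The random walk on $\mathcal S_{\mathbf c}$ that stays at $G$ with probability $1-D(G)/(2\Delta)$, and with probability $D(G)/(2\Delta)$ applies a uniformly chosen one of the $D(G)$ legal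 moves (and that always stays put if $\Delta=0$), is a Markov chain on $\mathcal S_{\mathbf c}$, the uniform distribution on $\mathcal S_{\mathbf c}$ is stationary for it, and from any starting graph $G$ its distribution after $t$ steps converges to this uniform distribution: for all $G,G'\in\mathcal S_{\mathbf c}$, $\Pr[G_t=G'\mid G_0=G]\to 1/|\mathcal S_{\mathbf c}|$ as $t\to\infty$. -/

import Mathlib

namespace CoreWalk

/-- The node set of the `k`-core of `G`: the union of all sets of nodes that induce a subgraph of
minimum degree at least `k`. -/
def core {V : Type*} (G : SimpleGraph V) (k : ℕ) : Set V :=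
  {v | ∃ S : Set V, v ∈ S ∧ ∀ u ∈ S, k ≤ (G.neighborSet u ∩ S).ncard}

/-- The core-value of `v`: the largest `k` such that `v` belongs to the `k`-core. -/
noncomputable def coreValue {V : Type*} (G : SimpleGraph V) (v : V) : ℕ :=
  sSup {k | v ∈ core G k}

/-- The subgraph induced on `core G k` is the greatest subgraph of minimum degree at least `k`. -/
theorem core_isGreatest {V : Type*} [Finite V] (G : SimpleGraph V) (k : ℕ) :
    IsGreatest {H : G.Subgraph | ∀ v ∈ H.verts, k ≤ (H.neighborSet v).ncard}
      ((⊤ : G.Subgraph).induce (core G k)) := by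
  constructor
  · rintro v ⟨S, hvS, hS⟩
    refine (hS v hvS).trans (Set.ncard_le_ncard ?_ (Set.toFinite _))
    rintro w ⟨hw, hwS⟩
    exact ⟨⟨S, hvS, hS⟩, ⟨S, hwS, hS⟩, hw⟩
  · intro H hH
    have key : ∀ v ∈ H.verts, v ∈ core G k := by
      intro v hv
      refine ⟨H.verts, hv, fun u hu => (hH u hu).trans
        (Set.ncard_le_ncard ?_ (Set.toFinite _))⟩
      intro w hw
      exact ⟨H.adj_sub hw, H.edge_vert (H.adj_symm hw)⟩
    refine ⟨key, ?_⟩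
    intro v w hvw
    exact ⟨key v (H.edge_vert hvw), key w (H.edge_vert (H.adj_symm hvw)), H.adj_sub hvw⟩

/-- On a finite graph the supremum defining the core-value is attained. -/
theorem coreValue_isGreatest {V : Type*} [Finite V] (G : SimpleGraph V) (v : V) :
    IsGreatest {k | v ∈ core G k} (coreValue G v) := by
  have hb : BddAbove {k | v ∈ core G k} := by
    refine ⟨Nat.card V, ?_⟩
    rintro k ⟨S, hvS, hS⟩
    exact (hS v hvS).trans (Set.ncard_le_card _)
  refine ⟨Nat.sSup_mem ⟨0, Set.univ, trivial, fun _ _ => Nat.zero_le _⟩ hb, ?_⟩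
  intro k hk
  exact le_csSup hb hk

/-- A move, recorded as the set of edges that it deletes and the set of edges that it inserts. -/
abbrev Move (V : Type*) := Set (Sym2 V) × Set (Sym2 V)

/-- The graph that results from `G` by deleting the edges `m.1` and inserting the edges `m.2`. -/
def Move.apply {V : Type*} (m : Move V) (G : SimpleGraph V) : SimpleGraph V :=
  SimpleGraph.fromEdgeSet ((G.edgeSet \ m.1) ∪ m.2)

/-- The move `m`, applied to `G`, affects no core-value. -/
def Move.Preserves {V : Type*} (m : Move V) (G : SimpleGraph V) : Prop :=
  ∀ v, coreValue (m.apply G) v = coreValue G v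

/-- The legal moves out of `G`: Add, Delete, Move Endpoint, Core Collapse, Core Expand, and the
half-move versions of the last two. -/
inductive CoreMove {V : Type*} (G : SimpleGraph V) : Move V → Prop
  | add (i j : V) (hne : i ≠ j) (hij : ¬ G.Adj i j)
      (hp : Move.Preserves (∅, {s(i, j)}) G) :
      CoreMove G (∅, {s(i, j)})
  | delete (i j : V) (hij : G.Adj i j)
      (hp : Move.Preserves ({s(i, j)}, ∅) G) :
      CoreMove G ({s(i, j)}, ∅)
  | moveEndpoint (h i j : V) (hc : coreValue G j < min (coreValue G h) (coreValue G i))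
      (hhj : G.Adj h j) (hij : ¬ G.Adj i j) :
      CoreMove G ({s(h, j)}, {s(i, j)})
  | coreCollapse (h i j : V) (hc : coreValue G i < coreValue G h)
      (hc' : coreValue G i = coreValue G j) (hne : i ≠ j)
      (hhi : G.Adj h i) (hhj : G.Adj h j) (hij : ¬ G.Adj i j)
      (hp : Move.Preserves ({s(h, i), s(h, j)}, {s(i, j)}) G) :
      CoreMove G ({s(h, i), s(h, j)}, {s(i, j)})
  | coreExpand (h i j : V) (hc : coreValue G i < coreValue G h)
      (hc' : coreValue G i = coreValue G j)
      (hij : G.Adj i j) (hhi : ¬ G.Adj h i) (hhj : ¬ G.Adj h j)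
      (hp : Move.Preserves ({s(i, j)}, {s(h, i), s(h, j)}) G) :
      CoreMove G ({s(i, j)}, {s(h, i), s(h, j)})
  | halfCollapse (h i j : V) (hc : coreValue G i < coreValue G h)
      (hc' : coreValue G i = coreValue G j) (hne : i ≠ j)
      (hhi : G.Adj h i) (hij : ¬ G.Adj i j)
      (hp : Move.Preserves ({s(h, i)}, {s(i, j)}) G) :
      CoreMove G ({s(h, i)}, {s(i, j)})
  | halfExpand (h i j : V) (hc : coreValue G i < coreValue G h)
      (hc' : coreValue G i = coreValue G j)
      (hij : G.Adj i j) (hhi : ¬ G.Adj h i)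
      (hp : Move.Preserves ({s(i, j)}, {s(h, i)}) G) :
      CoreMove G ({s(i, j)}, {s(h, i)})

/-- The node `v` belongs to the top core: it has the largest core-value. -/
def IsTop {V : Type*} (G : SimpleGraph V) (v : V) : Prop :=
  ∀ w, coreValue G w ≤ coreValue G v

/-- Switch moves in the top core: the edges `hi` and `jl` are replaced by `hj` and `il`.
(The adjacency conditions and `h ≠ j`, `i ≠ l` make the four nodes distinct.) -/
inductive TopSwitch {V : Type*} (G : SimpleGraph V) : Move V → Prop
  | mk (h i j l : V) (th : IsTop G h) (ti : IsTop G i) (tj : IsTop G j) (tl : IsTop G l)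
      (hne : h ≠ j) (hne' : i ≠ l)
      (hhi : G.Adj h i) (hjl : G.Adj j l) (hhj : ¬ G.Adj h j) (hil : ¬ G.Adj i l)
      (hp : Move.Preserves ({s(h, i), s(j, l)}, {s(h, j), s(i, l)}) G) :
      TopSwitch G ({s(h, i), s(j, l)}, {s(h, j), s(i, l)})

/-- The move set enhanced by the switch moves in the top core. -/
def CoreOrSwitchMove {V : Type*} (G : SimpleGraph V) (m : Move V) : Prop :=
  CoreMove G m ∨ TopSwitch G m

/-- The state space: all simple graphs on the nodes `Fin n` in which node `v` has core-value
`c v`. -/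
def StateSpace {n : ℕ} (c : Fin n → ℕ) : Type :=
  {G : SimpleGraph (Fin n) // ∀ v, coreValue G v = c v}

noncomputable instance {n : ℕ} (c : Fin n → ℕ) : Fintype (StateSpace c) :=
  @Fintype.ofFinite _ (inferInstanceAs
    (Finite {G : SimpleGraph (Fin n) // ∀ v, coreValue G v = c v}))

noncomputable instance {n : ℕ} (c : Fin n → ℕ) : DecidableEq (StateSpace c) :=
  Classical.decEq _

/-- Some legal move (with respect to the move set `L`) transforms `G` into `G'`: the adjacency
relation of the graph on the state space. -/
def Step {n : ℕ} (L : SimpleGraph (Fin n) → Move (Fin n) → Prop) (c : Fin n → ℕ)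
    (G G' : StateSpace c) : Prop :=
  ∃ m : Move (Fin n), L G.1 m ∧ m.apply G.1 = G'.1

/-- `D(G)`, the number of legal moves out of `G`. -/
noncomputable def numMoves {n : ℕ} (L : SimpleGraph (Fin n) → Move (Fin n) → Prop)
    (G : SimpleGraph (Fin n)) : ℕ :=
  {m : Move (Fin n) | L G m}.ncard

/-- `Δ`, the maximum number of legal moves out of any one graph in the state space. -/
noncomputable def maxMoves {n : ℕ} (L : SimpleGraph (Fin n) → Move (Fin n) → Prop)
    (c : Fin n → ℕ) : ℕ :=
  Finset.univ.sup fun G : StateSpace c => numMoves L G.1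

/-- The transition matrix of the lazy random walk: it stays at `G` with probability
`1 - D(G) / (2Δ)`, and with probability `D(G) / (2Δ)` it applies one of the `D(G)` legal moves out
of `G`, chosen uniformly, so that each single move has probability `1 / (2Δ)`.
(If `Δ = 0`, no move is ever legal; the quotients are then `0` and the walk stays put.) -/
noncomputable def walk {n : ℕ} (L : SimpleGraph (Fin n) → Move (Fin n) → Prop)
    (c : Fin n → ℕ) : Matrix (StateSpace c) (StateSpace c) ℝ :=
  Matrix.of fun G G' =>
    (if G = G' then 1 - (numMoves L G.1 : ℝ) / (2 * maxMoves L c) else 0) +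
      ({m : Move (Fin n) | L G.1 m ∧ m.apply G.1 = G'.1}.ncard : ℝ) / (2 * maxMoves L c)

/-- The uniform distribution on the state space. -/
noncomputable def uniform {n : ℕ} (c : Fin n → ℕ) : StateSpace c → ℝ :=
  fun _ => 1 / (Fintype.card (StateSpace c) : ℝ)

end CoreWalk

set_option linter.unusedSectionVars false

namespace CoreWalk

/-! ### Local description of graphs with prescribed core-values -/

variable {V : Type*} [Fintype V] [DecidableEq V] {c : V → ℕ} {Y : Finset V} {G H R : SimpleGraph V}

/-! Prescribing core-values amounts to two opposite conditions (`isCoreState_univ_iff`): every node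
has enough neighbours of at least its own value, and the graph is `Peelable`, which bounds the
values from above. The first survives adding edges, the second deleting them. Hence every graph
between two nested states is a state, and nested states are joined by additions alone
(`Reach.of_le`).

Connectivity is an induction on the node set `Y` (`IsCoreState.reach`). A state has a node `v` of
minimum value whose degree is exactly `c v`. After deleting `v` and refilling edges, the state
becomes a star with centre `v` and `c v` leaves on top of a state `R` on `Y.erase v`. By induction
`R` is arbitrary, so it remains to exchange one leaf for another on top of some convenient `R`
(`IsCoreState.exists_reach_swap`). A leaf of larger value than `v` makes this a single move. If all
values agree, temporarily deleting an edge of `R` at another leaf `u` makes `u` peelable before `v`,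
so that `v` may carry an extra leaf meanwhile. The only failure is four nodes of value 2, where the
top-core switch takes over. If the two given states have different minimum nodes, an intermediate
state serves both.

Moves are reversible, so the walk is symmetric, hence doubly stochastic; with laziness and
connectivity, an L1 contraction (`tendsto_pow_apply_of_doublyStochastic`) gives convergence to the
uniform distribution. -/

/-- Every nonempty subset `T` of `Y` has a node with few neighbours in `T` or of larger value. -/
def Peelable (c : V → ℕ) (Y : Finset V) (G : SimpleGraph V) : Prop :=
  ∀ T : Finset V, T.Nonempty → T ⊆ Y →
    ∃ v ∈ T, {u | G.Adj v u ∧ (u ∈ T ∨ c v < c u)}.ncard ≤ c v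

/-- The graph `G` lives on `Y`, and its core-value function on `Y` is `c`. -/
structure IsCoreState (c : V → ℕ) (Y : Finset V) (G : SimpleGraph V) : Prop where
  supp : ∀ a b, G.Adj a b → a ∈ Y
  low : ∀ v ∈ Y, c v ≤ {u | G.Adj v u ∧ c v ≤ c u}.ncard
  up : Peelable c Y G

theorem IsCoreState.supp_right (hG : IsCoreState c Y G) {a b : V} (h : G.Adj a b) : b ∈ Y :=
  hG.supp _ _ h.symm

theorem Peelable.anti (hG : Peelable c Y G) (h : H ≤ G) : Peelable c Y H := by
  intro T hT hTY
  obtain ⟨v, hv, hle⟩ := hG T hT hTY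
  refine ⟨v, hv, (Set.ncard_le_ncard ?_ (Set.toFinite _)).trans hle⟩
  exact fun u hu => ⟨h hu.1, hu.2⟩

/-- The condition `low` says that the nodes of value at least `k` induce minimum degree at least
`k`; peelability excludes any larger core. -/
theorem isCoreState_univ_iff :
    IsCoreState c Finset.univ G ↔ ∀ v, coreValue G v = c v := by
  constructor
  · intro hG v
    refine (coreValue_isGreatest G v).unique ⟨⟨{u | c v ≤ c u}, le_refl (c v), ?_⟩, ?_⟩
    · intro u (hu : c v ≤ c u)
      refine hu.trans ((hG.low u (Finset.mem_univ _)).trans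
        (Set.ncard_le_ncard ?_ (Set.toFinite _)))
      exact fun w hw => ⟨hw.1, hu.trans hw.2⟩
    · rintro k ⟨S, hvS, hS⟩
      classical
      -- Peel from the nodes of `S` of value at most `c v`: all neighbours of `w` in `S` are
      -- counted, so `k ≤ c w ≤ c v`.
      obtain ⟨w, hw, hle⟩ := hG.up (Finset.univ.filter fun u => u ∈ S ∧ c u ≤ c v)
        ⟨v, by simpa using hvS⟩ (Finset.subset_univ _)
      simp only [Finset.mem_filter, Finset.mem_univ, true_and] at hw hle
      refine (hS w hw.1).trans (le_trans (Set.ncard_le_ncard ?_ (Set.toFinite _))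
        (hle.trans hw.2))
      rintro x ⟨hx, hxS⟩
      refine ⟨hx, ?_⟩
      by_cases h : c x ≤ c v
      · exact Or.inl ⟨hxS, h⟩
      · exact Or.inr (by omega)
  · intro hG
    have low : ∀ v, c v ≤ {u | G.Adj v u ∧ c v ≤ c u}.ncard := by
      intro v
      obtain ⟨S, hvS, hS⟩ := (coreValue_isGreatest G v).1
      rw [hG v] at hS
      refine (hS v hvS).trans (Set.ncard_le_ncard ?_ (Set.toFinite _))
      rintro u ⟨hu, huS⟩
      exact ⟨hu, (hG u) ▸ (coreValue_isGreatest G u).2 ⟨S, huS, hS⟩⟩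
    refine ⟨fun _ _ _ => Finset.mem_univ _, fun v _ => low v, ?_⟩
    intro T hT _
    obtain ⟨v₀, hv₀, hmin⟩ := T.exists_min_image c hT
    by_contra! hcon
    -- If nothing in `T` can be peeled, then `T` together with all nodes of value above the minimum
    -- `c v₀` induces minimum degree at least `c v₀ + 1`.
    have hmem : v₀ ∈ core G (c v₀ + 1) := by
      refine ⟨{u | u ∈ T ∨ c v₀ < c u}, Or.inl hv₀, ?_⟩
      intro u hu
      by_cases h : c v₀ < c u
      · refine h.trans_le ((low u).trans (Set.ncard_le_ncard ?_ (Set.toFinite _)))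
        exact fun x hx => ⟨hx.1, Or.inr (h.trans_le hx.2)⟩
      · have huT : u ∈ T := hu.resolve_right h
        have := hmin u huT
        refine (show c v₀ + 1 ≤ c u + 1 by omega).trans
          (Nat.succ_le_of_lt (hcon u huT) |>.trans (Set.ncard_le_ncard ?_ (Set.toFinite _)))
        rintro x ⟨hx, hx'⟩
        exact ⟨hx, hx'.imp id fun h => by omega⟩
    have := (coreValue_isGreatest G v₀).2 hmem
    rw [hG] at this
    omega

/-! ### Moves between states, and nested states -/

/-- The effect on the edge set of those moves that suffice to connect the state space. -/
inductive EdgeMove (c : V → ℕ) : Set (Sym2 V) → Set (Sym2 V) → Prop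
  | add (i j : V) : EdgeMove c ∅ {s(i, j)}
  | delete (i j : V) : EdgeMove c {s(i, j)} ∅
  | shift (v a b : V) (ha : c v ≤ c a) (hb : c v ≤ c b) (hab : c v < max (c a) (c b)) :
      EdgeMove c {s(v, a)} {s(v, b)}
  | switch (h i j l : V) (hc : ∀ w, c w ≤ 2) (hh : c h = 2) (hi : c i = 2) (hj : c j = 2)
      (hl : c l = 2) (hne : h ≠ j) (hne' : i ≠ l) :
      EdgeMove c {s(h, i), s(j, l)} {s(h, j), s(i, l)}

/-- Reversing a switch needs `h ≠ i` and `j ≠ l`, which the constructor does not record; `hD`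
supplies them. -/
theorem EdgeMove.symm {D I : Set (Sym2 V)} (h : EdgeMove c D I) (hD : ∀ e ∈ D, ¬ e.IsDiag) :
    EdgeMove c I D := by
  cases h with
  | add i j => exact .delete i j
  | delete i j => exact .add i j
  | shift v a b ha hb hab => exact .shift v b a hb ha (by rwa [max_comm])
  | switch h i j l hc hh hi hj hl hne hne' =>
    refine .switch h j i l hc hh hj hi hl ?_ ?_
    · simpa using hD s(h, i) (by simp)
    · simpa using hD s(j, l) (by simp)

/-- Two states on `Y` that differ by one move. -/
def Link (c : V → ℕ) (Y : Finset V) (G H : SimpleGraph V) : Prop :=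
  IsCoreState c Y G ∧ IsCoreState c Y H ∧
    EdgeMove c (G.edgeSet \ H.edgeSet) (H.edgeSet \ G.edgeSet)

/-- Two states on `Y` that are connected by moves. -/
def Reach (c : V → ℕ) (Y : Finset V) : SimpleGraph V → SimpleGraph V → Prop :=
  Relation.ReflTransGen (Link c Y)

theorem Link.symm (h : Link c Y G H) : Link c Y H G :=
  ⟨h.2.1, h.1, h.2.2.symm fun _ he => G.not_isDiag_of_mem_edgeSet he.1⟩

theorem Reach.symm (h : Reach c Y G H) : Reach c Y H G := by
  have : Std.Symm (Link c Y) := ⟨fun _ _ => Link.symm⟩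
  exact Relation.ReflTransGen.stdSymm.symm _ _ h

theorem Reach.trans {K : SimpleGraph V} (h : Reach c Y G H) (h' : Reach c Y H K) :
    Reach c Y G K :=
  Relation.ReflTransGen.trans h h'

theorem IsCoreState.of_between {K : SimpleGraph V} (hG : IsCoreState c Y G)
    (hK : IsCoreState c Y K) (h : G ≤ H) (h' : H ≤ K) : IsCoreState c Y H where
  supp a b hab := hK.supp a b (h' hab)
  low v hv := (hG.low v hv).trans
    (Set.ncard_le_ncard (fun _ hu => ⟨h hu.1, hu.2⟩) (Set.toFinite _))
  up := hK.up.anti h'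

/-- The missing edges are inserted one at a time; `IsCoreState.of_between` makes every intermediate
graph a state. -/
theorem Reach.of_le (hG : IsCoreState c Y G) (hH : IsCoreState c Y H) (h : G ≤ H) :
    Reach c Y G H := by
  induction hd : (H.edgeSet \ G.edgeSet).ncard using Nat.strong_induction_on generalizing G with
  | _ d ih =>
  by_cases heq : H ≤ G
  · rw [le_antisymm h heq]
    exact .refl
  · obtain ⟨a, b, hab, hab'⟩ : ∃ a b, H.Adj a b ∧ ¬ G.Adj a b := by
      by_contra! hcon
      exact heq fun a b hab => hcon a b hab
    have hne := hab.ne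
    have hle : G ⊔ SimpleGraph.edge a b ≤ H :=
      sup_le h (by rw [SimpleGraph.edge_le_iff]; exact Or.inr hab)
    have hst := hG.of_between hH le_sup_left hle
    have hedge : (G ⊔ SimpleGraph.edge a b).edgeSet = G.edgeSet ∪ {s(a, b)} := by
      rw [SimpleGraph.edgeSet_sup, SimpleGraph.edgeSet_edge_of_ne hne]
    have hlink : Link c Y G (G ⊔ SimpleGraph.edge a b) := by
      refine ⟨hG, hst, ?_⟩
      have h1 : G.edgeSet \ (G ⊔ SimpleGraph.edge a b).edgeSet = ∅ := by
        rw [hedge, Set.sdiff_eq_empty]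
        exact Set.subset_union_left
      have h2 : (G ⊔ SimpleGraph.edge a b).edgeSet \ G.edgeSet = {s(a, b)} := by
        rw [hedge, Set.union_sdiff_left]
        simpa using hab'
      rw [h1, h2]
      exact .add a b
    refine .head hlink (ih _ ?_ hst hle rfl)
    rw [← hd]
    refine Set.ncard_lt_ncard ⟨?_, ?_⟩ (Set.toFinite _)
    · rw [hedge]
      exact Set.sdiff_subset_sdiff_right Set.subset_union_left
    · intro hsub
      have := hsub (show s(a, b) ∈ H.edgeSet \ G.edgeSet from ⟨hab, hab'⟩)
      rw [hedge] at this
      simp at this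

/-! ### Extending peelable graphs to states -/

/-- Every node of `Y` has enough candidates for neighbours. -/
def Roomy (c : V → ℕ) (Y : Finset V) : Prop :=
  ∀ v ∈ Y, c v ≤ ((Y.erase v).filter fun x => c v ≤ c x).card

theorem IsCoreState.roomy (hG : IsCoreState c Y G) : Roomy c Y := by
  intro v hv
  refine (hG.low v hv).trans ?_
  rw [← Set.ncard_coe_finset]
  refine Set.ncard_le_ncard (fun u hu => ?_) (Set.toFinite _)
  simp [hu.2, hu.1.ne', hG.supp_right hu.1]

/-- If `T` contains `v`, then either `T` has nodes of smaller value, and peeling among those never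
sees the new edge, or `v` itself has at most `c v` counted neighbours. If `v ∉ T`, the new edge is
not counted at `x`, because `c v ≤ c x`. -/
theorem Peelable.sup_edge (hG : Peelable c Y G) {v x : V} (hx : c v ≤ c x)
    (hd : {u | G.Adj v u ∧ c v ≤ c u}.ncard < c v) :
    Peelable c Y (G ⊔ SimpleGraph.edge v x) := by
  intro T hT hTY
  by_cases hv : v ∈ T
  · by_cases hlow : (T.filter fun u => c u < c v).Nonempty
    · obtain ⟨w, hw, hle⟩ := hG _ hlow ((Finset.filter_subset _ _).trans hTY)
      simp only [Finset.mem_filter] at hw hle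
      refine ⟨w, hw.1, (Set.ncard_le_ncard ?_ (Set.toFinite _)).trans hle⟩
      rintro u ⟨hu, hu'⟩
      have h1 : w ≠ v := by rintro rfl; omega
      have h2 : w ≠ x := by rintro rfl; omega
      refine ⟨?_, ?_⟩
      · simpa [SimpleGraph.edge_adj, h1, h2] using hu
      · by_cases h : c u < c v
        · exact hu'.imp (fun h' => ⟨h', h⟩) id
        · right; omega
    · refine ⟨v, hv, ?_⟩
      have hsub : {u | (G ⊔ SimpleGraph.edge v x).Adj v u ∧ (u ∈ T ∨ c v < c u)} ⊆
          insert x {u | G.Adj v u ∧ c v ≤ c u} := by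
        rintro u ⟨hu, hu'⟩
        have hcu : c v ≤ c u := by
          rcases hu' with h | h
          · by_contra hlt
            exact hlow ⟨u, by simp [h]; omega⟩
          · exact h.le
        simp only [SimpleGraph.sup_adj, SimpleGraph.edge_adj] at hu
        simp only [Set.mem_insert_iff, Set.mem_ofPred_eq]
        grind
      have := (Set.ncard_le_ncard hsub (Set.toFinite _)).trans (Set.ncard_insert_le _ _)
      omega
  · obtain ⟨w, hw, hle⟩ := hG T hT hTY
    refine ⟨w, hw, (Set.ncard_le_ncard ?_ (Set.toFinite _)).trans hle⟩
    rintro u ⟨hu, hu'⟩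
    refine ⟨?_, hu'⟩
    simp only [SimpleGraph.sup_adj, SimpleGraph.edge_adj] at hu
    grind

/-- In an edge-maximal peelable graph no node can lack neighbours: roominess would offer it a new
one, and `Peelable.sup_edge` would allow that edge. -/
theorem Peelable.exists_isCoreState (hY : Roomy c Y) (hs : ∀ a b, G.Adj a b → a ∈ Y)
    (hG : Peelable c Y G) : ∃ H, G ≤ H ∧ IsCoreState c Y H := by
  obtain ⟨H, hGH, hmax⟩ := Finite.exists_le_maximal
    (p := fun H : SimpleGraph V => (∀ a b, H.Adj a b → a ∈ Y) ∧ Peelable c Y H) ⟨hs, hG⟩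
  refine ⟨H, hGH, hmax.prop.1, ?_, hmax.prop.2⟩
  intro v hv
  by_contra! hlt
  have hex : ∃ x ∈ (Y.erase v).filter (fun x => c v ≤ c x), ¬ H.Adj v x := by
    by_contra! hcon
    refine absurd (hY v hv) (not_le.2 (lt_of_le_of_lt ?_ hlt))
    rw [← Set.ncard_coe_finset]
    refine Set.ncard_le_ncard (fun u hu => ?_) (Set.toFinite _)
    exact ⟨hcon u hu, (Finset.mem_filter.1 hu).2⟩
  obtain ⟨x, hx, hvx⟩ := hex
  simp only [Finset.mem_filter, Finset.mem_erase] at hx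
  refine hvx (hmax.le_of_ge ⟨?_, hmax.prop.2.sup_edge hx.2 hlt⟩ le_sup_left
    (show (H ⊔ SimpleGraph.edge v x).Adj v x by simp [SimpleGraph.edge_adj, hx.1.1.symm]))
  intro a b hab
  simp only [SimpleGraph.sup_adj, SimpleGraph.edge_adj] at hab
  have := hmax.prop.1 a b
  grind

/-! ### Splitting off a star around a node of minimum value -/

/-- The star with centre `v` and leaves `A`. -/
def star (v : V) (A : Finset V) : SimpleGraph V where
  Adj a b := (a = v ∧ b ∈ A ∨ b = v ∧ a ∈ A) ∧ a ≠ b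
  symm := ⟨fun _ _ h => ⟨h.1.symm, h.2.symm⟩⟩
  loopless := ⟨fun _ h => h.2 rfl⟩

theorem star_adj {v a b : V} {A : Finset V} :
    (star v A).Adj a b ↔ (a = v ∧ b ∈ A ∨ b = v ∧ a ∈ A) ∧ a ≠ b := Iff.rfl

theorem sup_star_adj_center {v : V} {A : Finset V} (hA : A ⊆ Y.erase v)
    (hR : ∀ a b, R.Adj a b → a ∈ Y.erase v) (u : V) : (R ⊔ star v A).Adj v u ↔ u ∈ A := by
  have h1 := hR v u
  have h2 := @hA u
  simp only [SimpleGraph.sup_adj, star_adj, Finset.mem_erase] at *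
  grind

/-- The centre can be peeled by its degree. As long as it is outside `T`, its minimum value keeps
the star edges from being counted at the leaves. -/
theorem Peelable.sup_star {v : V} (hR : Peelable c (Y.erase v) R) {A : Finset V} (hA : A ⊆ Y.erase v)
    (hmin : ∀ u ∈ Y, c v ≤ c u) (hs : ∀ a b, R.Adj a b → a ∈ Y.erase v) (hc : A.card ≤ c v) :
    Peelable c Y (R ⊔ star v A) := by
  intro T hT hTY
  by_cases hv : v ∈ T
  · refine ⟨v, hv, le_trans ?_ hc⟩
    rw [← Set.ncard_coe_finset]
    exact Set.ncard_le_ncard (fun u hu => (sup_star_adj_center hA hs u).1 hu.1) (Set.toFinite _)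
  · obtain ⟨w, hw, hle⟩ := hR T hT (fun u hu => Finset.mem_erase.2 ⟨fun h => hv (h ▸ hu), hTY hu⟩)
    refine ⟨w, hw, (Set.ncard_le_ncard ?_ (Set.toFinite _)).trans hle⟩
    rintro u ⟨hu, hu'⟩
    refine ⟨?_, hu'⟩
    have := hmin w (hTY hw)
    simp only [SimpleGraph.sup_adj, star_adj] at hu
    grind

theorem IsCoreState.sup_star {v : V} (hR : IsCoreState c (Y.erase v) R) {A : Finset V}
    (hv : v ∈ Y) (hmin : ∀ u ∈ Y, c v ≤ c u) (hA : A ⊆ Y.erase v) (hc : A.card = c v) :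
    IsCoreState c Y (R ⊔ star v A) where
  supp a b hab := by
    have h1 := hR.supp a b
    have h2 := @hA a
    simp only [SimpleGraph.sup_adj, star_adj, Finset.mem_erase] at *
    grind
  low u hu := by
    by_cases h : u = v
    · subst h
      refine hc.symm.le.trans ?_
      rw [← Set.ncard_coe_finset]
      refine Set.ncard_le_ncard (fun w hw => ⟨(sup_star_adj_center hA hR.supp w).2 hw,
        hmin w (Finset.mem_of_mem_erase (hA hw))⟩)
        (Set.toFinite _)
    · refine (hR.low u (Finset.mem_erase.2 ⟨h, hu⟩)).trans
        (Set.ncard_le_ncard (fun w hw => ⟨Or.inl hw.1, hw.2⟩) (Set.toFinite _))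
  up := hR.up.sup_star hA hmin hR.supp hc.le

theorem edgeSet_sup_star_sdiff {v : V} {A : Finset V} (hG : ∀ a b, G.Adj a b → a ∈ Y.erase v) :
    (G ⊔ star v A).edgeSet \ (H ⊔ star v A).edgeSet = G.edgeSet \ H.edgeSet := by
  ext e
  induction e using Sym2.ind with
  | _ a b =>
    have h1 := hG a b
    have h2 := hG b a
    have h3 := G.adj_comm a b
    simp only [Set.mem_sdiff, SimpleGraph.mem_edgeSet, SimpleGraph.sup_adj, star_adj,
      Finset.mem_erase] at *
    grind

theorem Reach.sup_star {v : V} {R' : SimpleGraph V} (h : Reach c (Y.erase v) R R') {A : Finset V}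
    (hv : v ∈ Y) (hmin : ∀ u ∈ Y, c v ≤ c u) (hA : A ⊆ Y.erase v) (hc : A.card = c v) :
    Reach c Y (R ⊔ star v A) (R' ⊔ star v A) := by
  refine Relation.ReflTransGen.lift (r := Link c (Y.erase v)) (fun G => G ⊔ star v A) ?_ _ _ h
  rintro G H ⟨hG, hH, hm⟩
  refine ⟨hG.sup_star hv hmin hA hc, hH.sup_star hv hmin hA hc, ?_⟩
  rwa [edgeSet_sup_star_sdiff hG.supp, edgeSet_sup_star_sdiff hH.supp]

/-- Without a node `v` of minimum value, `Y` still has enough room unless it is a clique. -/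
theorem IsCoreState.roomy_erase {v : V} (hG : IsCoreState c Y G) (hv : v ∈ Y)
    (hmin : ∀ u ∈ Y, c v ≤ c u) (hcard : c v + 2 ≤ Y.card) : Roomy c (Y.erase v) := by
  intro u hu
  have hu' := Finset.mem_erase.1 hu
  by_cases h : c u = c v
  · have : ((Y.erase v).erase u).filter (fun x => c u ≤ c x) = (Y.erase v).erase u := by
      refine Finset.filter_true_of_mem fun x hx => ?_
      rw [h]
      exact hmin x (Finset.mem_of_mem_erase (Finset.mem_of_mem_erase hx))
    rw [this, Finset.card_erase_of_mem hu, Finset.card_erase_of_mem hv]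
    omega
  · refine (hG.roomy u hu'.2).trans (Finset.card_le_card fun x hx => ?_)
    have := hmin u hu'.2
    simp only [Finset.mem_filter, Finset.mem_erase] at hx ⊢
    refine ⟨⟨hx.1.1, ?_, hx.1.2⟩, hx.2⟩
    rintro rfl
    omega

theorem IsCoreState.le_ncard_neighborSet (hG : IsCoreState c Y G) {v : V} (hv : v ∈ Y) :
    c v ≤ {u | G.Adj v u}.ncard :=
  (hG.low v hv).trans (Set.ncard_le_ncard (fun _ hu => hu.1) (Set.toFinite _))

theorem IsCoreState.ncard_neighborSet_lt (hG : IsCoreState c Y G) {v : V} (hv : v ∈ Y) :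
    {u | G.Adj v u}.ncard < Y.card := by
  refine Nat.lt_of_lt_of_le (Nat.lt_succ_of_le ?_) (Finset.card_erase_add_one hv).le
  rw [← Set.ncard_coe_finset]
  exact Set.ncard_le_ncard (fun u hu => Finset.mem_coe.2
    (Finset.mem_erase.2 ⟨hu.ne', hG.supp_right hu⟩)) (Set.toFinite _)

/-- On a minimal set the only state is the complete graph. -/
theorem IsCoreState.adj_of_card_le (hG : IsCoreState c Y G) {v a b : V}
    (hmin : ∀ u ∈ Y, c v ≤ c u) (hcard : Y.card ≤ c v + 1) (ha : a ∈ Y) (hb : b ∈ Y)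
    (hne : a ≠ b) : G.Adj a b := by
  have hsub : {u | G.Adj a u} ⊆ (Y.erase a : Finset V) := fun u hu => Finset.mem_coe.2
    (Finset.mem_erase.2 ⟨hu.ne', hG.supp_right hu⟩)
  have heq := Set.eq_of_subset_of_ncard_le hsub (by
    rw [Set.ncard_coe_finset, Finset.card_erase_of_mem ha]
    have := hG.le_ncard_neighborSet ha
    have := hmin a ha
    omega) (Set.toFinite _)
  have : b ∈ {u | G.Adj a u} := heq ▸ Finset.mem_coe.2 (Finset.mem_erase.2 ⟨hne.symm, hb⟩)
  exact this

theorem IsCoreState.eq_of_card_le (hG : IsCoreState c Y G) (hH : IsCoreState c Y H) {v : V}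
    (hmin : ∀ u ∈ Y, c v ≤ c u) (hcard : Y.card ≤ c v + 1) : G = H := by
  ext a b
  exact ⟨fun h => hH.adj_of_card_le hmin hcard (hG.supp _ _ h) (hG.supp_right h) h.ne,
    fun h => hG.adj_of_card_le hmin hcard (hH.supp _ _ h) (hH.supp_right h) h.ne⟩

/-- Some node of minimum value has as few neighbours as possible. -/
theorem IsCoreState.exists_min (hG : IsCoreState c Y G) (hY : Y.Nonempty) :
    ∃ v ∈ Y, (∀ u ∈ Y, c v ≤ c u) ∧ {u | G.Adj v u}.ncard ≤ c v := by
  obtain ⟨v₀, hv₀, hmin⟩ := Y.exists_min_image c hY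
  -- Peeling among the nodes of minimum value counts every neighbour, so it bounds the full degree.
  obtain ⟨v, hv, hle⟩ := hG.up (Y.filter fun u => c u = c v₀) ⟨v₀, by simp [hv₀]⟩
    (Finset.filter_subset _ _)
  simp only [Finset.mem_filter] at hv hle
  refine ⟨v, hv.1, fun u hu => hv.2 ▸ hmin u hu,
    (Set.ncard_le_ncard ?_ (Set.toFinite _)).trans hle⟩
  intro u hu
  have h1 := hG.supp_right hu
  have h2 := hmin u h1
  refine ⟨hu, ?_⟩
  by_cases h : c u = c v₀
  · exact Or.inl ⟨h1, h⟩
  · right; omega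

/-- A state with a node `v` of smallest possible value and degree can be moved to a star around
`v` on top of a state on the other nodes. -/
theorem IsCoreState.exists_reach_sup_star (hG : IsCoreState c Y G) {v : V} (hv : v ∈ Y)
    (hmin : ∀ u ∈ Y, c v ≤ c u) (hcard : c v + 2 ≤ Y.card)
    (hdeg : {u | G.Adj v u}.ncard ≤ c v) :
    ∃ R A, IsCoreState c (Y.erase v) R ∧ A ⊆ Y.erase v ∧ A.card = c v ∧
      Reach c Y G (R ⊔ star v A) := by
  classical
  let R₀ : SimpleGraph V := G.deleteIncidenceSet v
  have hR₀ : ∀ a b, R₀.Adj a b ↔ G.Adj a b ∧ a ≠ v ∧ b ≠ v := by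
    intro a b
    rw [SimpleGraph.deleteIncidenceSet_adj]
  have hle : R₀ ≤ G := fun a b h => ((hR₀ a b).1 h).1
  -- Removing `v` may leave neighbours of the same value short of edges; peelability survives, so
  -- the lost edges can be refilled.
  obtain ⟨R, hRR, hR⟩ := Peelable.exists_isCoreState (G := R₀)
    (hG.roomy_erase hv hmin hcard)
    (fun a b h => Finset.mem_erase.2 ⟨((hR₀ a b).1 h).2.1, hG.supp _ _ (hle h)⟩)
    (fun T hT hTY => hG.up.anti hle T hT (hTY.trans (Finset.erase_subset _ _)))
  let A : Finset V := Finset.univ.filter fun u => G.Adj v u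
  have hA : A ⊆ Y.erase v := fun u hu => by
    have hu : G.Adj v u := by simpa [A] using hu
    exact Finset.mem_erase.2 ⟨hu.ne', hG.supp_right hu⟩
  have hAc : A.card = c v := by
    have : {u | G.Adj v u} = (A : Set V) := by ext; simp [A]
    have h1 := hG.le_ncard_neighborSet hv
    rw [this, Set.ncard_coe_finset] at hdeg h1
    omega
  refine ⟨R, A, hR, hA, hAc, Reach.of_le hG (hR.sup_star hv hmin hA hAc) ?_⟩
  intro a b hab
  rw [SimpleGraph.sup_adj, star_adj]
  by_cases ha : a = v
  · subst ha
    exact Or.inr ⟨Or.inl ⟨rfl, by simpa [A] using hab⟩, hab.ne⟩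
  · by_cases hb : b = v
    · subst hb
      exact Or.inr ⟨Or.inr ⟨rfl, by simpa [A] using hab.symm⟩, hab.ne⟩
    · exact Or.inl (hRR ((hR₀ a b).2 ⟨hab, ha, hb⟩))

theorem Roomy.exists_isCoreState (hY : Roomy c Y) : ∃ G, IsCoreState c Y G := by
  obtain ⟨G, -, hG⟩ := Peelable.exists_isCoreState (G := ⊥) hY (by simp) (by
    rintro T ⟨v, hv⟩ -
    exact ⟨v, hv, by simp⟩)
  exact ⟨G, hG⟩

/-! ### Exchanging one leaf of the star -/

theorem insert_erase_subset {A : Finset V} {v w w' : V} (hA : A ⊆ Y.erase v)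
    (hw' : w' ∈ Y.erase v) : insert w' (A.erase w) ⊆ Y.erase v :=
  Finset.insert_subset hw' ((Finset.erase_subset _ _).trans hA)

theorem card_insert_erase {A : Finset V} {w w' : V} (hw : w ∈ A) (hw' : w' ∉ A) :
    (insert w' (A.erase w)).card = A.card := by
  rw [Finset.card_insert_of_notMem (fun h => hw' (Finset.mem_of_mem_erase h)),
    Finset.card_erase_add_one hw]

theorem edgeSet_sup_star_sdiff_sup_star {v w : V} {A B : Finset V}
    (hA : A ⊆ Y.erase v) (hR : ∀ a b, R.Adj a b → a ∈ Y.erase v) (hw : w ∈ A)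
    (hB : ∀ x ∈ A, x ∉ B ↔ x = w) :
    (R ⊔ star v A).edgeSet \ (R ⊔ star v B).edgeSet = {s(v, w)} := by
  ext e
  induction e using Sym2.ind with
  | _ a b =>
    have h1 := hR a b
    have h2 := hR b a
    have h3 := R.adj_comm a b
    have h4 := @hA a
    have h5 := @hA b
    have h6 := @hA w
    have h7 := hB a
    have h8 := hB b
    simp only [Set.mem_sdiff, SimpleGraph.mem_edgeSet, SimpleGraph.sup_adj, star_adj,
      Finset.mem_erase, Set.mem_singleton_iff, Sym2.eq_iff] at *
    grind

/-- One shift suffices: it is a Move Endpoint if both leaves have larger value than `v`, and a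
half-move if only one does. -/
theorem IsCoreState.reach_swap_of_lt {v w w' : V} {A : Finset V}
    (hR : IsCoreState c (Y.erase v) R) (hv : v ∈ Y) (hmin : ∀ u ∈ Y, c v ≤ c u)
    (hA : A ⊆ Y.erase v) (hc : A.card = c v) (hw : w ∈ A) (hw' : w' ∈ Y.erase v) (hwA : w' ∉ A)
    (hlt : c v < max (c w) (c w')) :
    Reach c Y (R ⊔ star v A) (R ⊔ star v (insert w' (A.erase w))) := by
  have hA' := insert_erase_subset (w := w) hA hw'
  refine .single ⟨hR.sup_star hv hmin hA hc,
    hR.sup_star hv hmin hA' (by rw [card_insert_erase hw hwA, hc]), ?_⟩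
  rw [edgeSet_sup_star_sdiff_sup_star hA hR.supp hw (by grind),
    edgeSet_sup_star_sdiff_sup_star (w := w') hA' hR.supp (by simp) (by grind)]
  exact .shift v w w' (hmin _ (Finset.mem_of_mem_erase (hA hw)))
    (hmin _ (Finset.mem_of_mem_erase hw')) hlt

/-- Having traded `x` for `v`, the node `u` keeps degree `c v` and can be peeled first. Then `v` has
at most `c v` leaves left even if `S` has one too many, and the rest peels as in `R`. The loss of
`u` at `x` is made up by `v`, or absorbed by a surplus neighbour. -/
theorem IsCoreState.sdiff_edge_sup_star {v u x w : V} {A S : Finset V}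
    (hR : IsCoreState c (Y.erase v) R) (hv : v ∈ Y) (hall : ∀ y ∈ Y, c y = c v)
    (hS : S ⊆ Y.erase v) (hSl : c v ≤ S.card) (hSu : S.card ≤ c v + 1) (hAS : A.erase w ⊆ S)
    (hu : u ∈ A) (huw : u ≠ w) (hux : R.Adj u x) (hdeg : {y | R.Adj u y}.ncard ≤ c v)
    (hx : x ∈ A.erase w ∨ c v < {y | R.Adj x y}.ncard) :
    IsCoreState c Y (R \ SimpleGraph.edge u x ⊔ star v S) := by
  have hs : ∀ a b, (R \ SimpleGraph.edge u x).Adj a b → a ∈ Y.erase v :=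
    fun a b h => hR.supp a b h.1
  have huS : u ∈ S := hAS (Finset.mem_erase.2 ⟨huw, hu⟩)
  have hsupp : ∀ a b, (R \ SimpleGraph.edge u x ⊔ star v S).Adj a b → a ∈ Y := by
    intro a b hab
    have h1 := hs a b
    have h2 := @hS a
    simp only [SimpleGraph.sup_adj, star_adj, Finset.mem_erase] at *
    grind
  refine ⟨hsupp, ?_, ?_⟩
  · intro y hy
    have key : ∀ B : Set V, B ⊆ {z | (R \ SimpleGraph.edge u x ⊔ star v S).Adj y z} →
        c v ≤ B.ncard →
        c y ≤ {z | (R \ SimpleGraph.edge u x ⊔ star v S).Adj y z ∧ c y ≤ c z}.ncard := by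
      intro B hB hle
      rw [hall y hy]
      refine hle.trans (Set.ncard_le_ncard (fun z hz => ⟨hB hz, ?_⟩) (Set.toFinite _))
      exact (hall z (hsupp _ _ (hB hz).symm)).ge
    by_cases hyv : y = v
    · subst hyv
      refine key S (fun z hz => (sup_star_adj_center hS hs z).2 hz) ?_
      rwa [Set.ncard_coe_finset]
    have hyd := hR.le_ncard_neighborSet (Finset.mem_erase.2 ⟨hyv, hy⟩)
    rw [hall y hy] at hyd
    have hvN : ∀ z, v ∉ {y | R.Adj z y} := fun z hz =>
      absurd (hR.supp_right hz) (Finset.notMem_erase v Y)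
    by_cases hyu : y = u
    · subst hyu
      refine key (insert v ({z | R.Adj y z} \ {x})) ?_ ?_
      · intro z hz
        simp only [Set.mem_insert_iff, Set.mem_sdiff, Set.mem_ofPred_eq, Set.mem_singleton_iff,
          SimpleGraph.sup_adj, SimpleGraph.sdiff_adj, SimpleGraph.edge_adj, star_adj] at hz ⊢
        grind
      · rwa [Set.ncard_exchange (hvN y) hux]
    by_cases hyx : y = x
    · subst hyx
      rcases hx with hx | hx
      · have hyS := hAS hx
        refine key (insert v ({z | R.Adj y z} \ {u})) ?_ ?_
        · intro z hz
          simp only [Set.mem_insert_iff, Set.mem_sdiff, Set.mem_ofPred_eq, Set.mem_singleton_iff,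
            SimpleGraph.sup_adj, SimpleGraph.sdiff_adj, SimpleGraph.edge_adj, star_adj] at hz ⊢
          grind
        · rwa [Set.ncard_exchange (hvN y) hux.symm]
      · refine key ({z | R.Adj y z} \ {u}) ?_ ?_
        · intro z hz
          simp only [Set.mem_sdiff, Set.mem_ofPred_eq, Set.mem_singleton_iff,
            SimpleGraph.sup_adj, SimpleGraph.sdiff_adj, SimpleGraph.edge_adj] at hz ⊢
          grind
        · have := Set.ncard_sdiff_singleton_add_one (show u ∈ {z | R.Adj y z} from hux.symm)
            (Set.toFinite _)
          omega
    · refine key {z | R.Adj y z} ?_ hyd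
      intro z hz
      simp only [Set.mem_ofPred_eq,
        SimpleGraph.sup_adj, SimpleGraph.sdiff_adj, SimpleGraph.edge_adj] at hz ⊢
      grind
  · intro T hT hTY
    by_cases huT : u ∈ T
    · refine ⟨u, huT, ?_⟩
      rw [hall u (hTY huT)]
      refine le_trans ?_ ((Set.ncard_exchange (fun hz => absurd (hR.supp_right hz)
        (Finset.notMem_erase v Y)) (show x ∈ {y | R.Adj u y} from hux)).le.trans hdeg)
      refine Set.ncard_le_ncard ?_ (Set.toFinite _)
      rintro z ⟨hz, -⟩
      change z ∈ insert v ({y | R.Adj u y} \ {x})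
      simp only [Set.mem_insert_iff, Set.mem_sdiff, Set.mem_ofPred_eq, Set.mem_singleton_iff,
        SimpleGraph.sup_adj, SimpleGraph.sdiff_adj, SimpleGraph.edge_adj, star_adj] at hz ⊢
      have := hux.ne
      grind
    by_cases hvT : v ∈ T
    · refine ⟨v, hvT, ?_⟩
      refine le_trans ?_ (show (S.erase u).card ≤ c v by
        rw [Finset.card_erase_of_mem huS]; omega)
      rw [← Set.ncard_coe_finset]
      refine Set.ncard_le_ncard ?_ (Set.toFinite _)
      rintro z ⟨hz, hz'⟩
      rw [sup_star_adj_center hS hs] at hz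
      refine Finset.mem_coe.2 (Finset.mem_erase.2 ⟨?_, hz⟩)
      rintro rfl
      have := hall z (Finset.mem_of_mem_erase (hS huS))
      exact hz'.elim huT (by omega)
    · obtain ⟨y, hy, hle⟩ := hR.up T hT
        (fun z hz => Finset.mem_erase.2 ⟨fun h => hvT (h ▸ hz), hTY hz⟩)
      refine ⟨y, hy, (Set.ncard_le_ncard ?_ (Set.toFinite _)).trans hle⟩
      rintro z ⟨hz, hz'⟩
      refine ⟨?_, hz'⟩
      have := hall y (hTY hy)
      simp only [SimpleGraph.sup_adj, SimpleGraph.sdiff_adj, star_adj] at hz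
      grind

/-- With the edge `ux` deleted, `v` can hold both `w` and `w'`: delete `ux`, insert `vw'`, delete
`vw`, reinsert `ux`. -/
theorem IsCoreState.reach_swap_of_eq {v u x w w' : V} {A : Finset V}
    (hR : IsCoreState c (Y.erase v) R) (hv : v ∈ Y) (hall : ∀ y ∈ Y, c y = c v)
    (hA : A ⊆ Y.erase v) (hc : A.card = c v) (hw : w ∈ A) (hw' : w' ∈ Y.erase v) (hwA : w' ∉ A)
    (hu : u ∈ A) (huw : u ≠ w) (hux : R.Adj u x) (hdeg : {y | R.Adj u y}.ncard ≤ c v)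
    (hx : x ∈ A.erase w ∨ c v < {y | R.Adj x y}.ncard) :
    Reach c Y (R ⊔ star v A) (R ⊔ star v (insert w' (A.erase w))) := by
  have hmin : ∀ y ∈ Y, c v ≤ c y := fun y hy => (hall y hy).ge
  have hA' := insert_erase_subset (w := w) hA hw'
  have hc' : (insert w' (A.erase w)).card = c v := by rw [card_insert_erase hw hwA, hc]
  have mk : ∀ S : Finset V, S ⊆ Y.erase v → c v ≤ S.card → S.card ≤ c v + 1 → A.erase w ⊆ S →
      IsCoreState c Y (R \ SimpleGraph.edge u x ⊔ star v S) := fun S h1 h2 h3 h4 =>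
    hR.sdiff_edge_sup_star hv hall h1 h2 h3 h4 hu huw hux hdeg hx
  have s1 := mk A hA hc.ge (by omega) (Finset.erase_subset _ _)
  have s3 := mk _ hA' hc'.ge (by omega) (Finset.subset_insert _ _)
  have s2 := mk (insert w' A) (Finset.insert_subset hw' hA)
    (by rw [Finset.card_insert_of_notMem hwA]; omega)
    (by rw [Finset.card_insert_of_notMem hwA]; omega)
    ((Finset.erase_subset _ _).trans (Finset.subset_insert _ _))
  have mono : ∀ S S' : Finset V, S ⊆ S' → star v S ≤ star v S' :=
    fun S S' h a b hab => ⟨hab.1.imp (And.imp_right (@h b)) (And.imp_right (@h a)), hab.2⟩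
  refine (Reach.of_le s1 (hR.sup_star hv hmin hA hc) (sup_le_sup_right sdiff_le _)).symm.trans ?_
  refine (Reach.of_le s1 s2 (sup_le_sup_left (mono _ _ (Finset.subset_insert _ _)) _)).trans ?_
  refine (Reach.of_le s3 s2 (sup_le_sup_left (mono _ _
    (Finset.insert_subset_insert _ (Finset.erase_subset _ _))) _)).symm.trans ?_
  exact Reach.of_le s3 (hR.sup_star hv hmin hA' hc') (sup_le_sup_right sdiff_le _)

/-- The graph is the four-cycle `v a d b`, so every node has two neighbours; peelability is
inherited from the cycle plus the chord `ab`. -/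
theorem IsCoreState.fourCycle {v a b d : V} (hR : IsCoreState c (Y.erase v) R) (hv : v ∈ Y)
    (hall : ∀ y ∈ Y, c y = 2) (hY : Y.erase v = {a, b, d}) (hab : R.Adj a b) (had : R.Adj a d)
    (hbd : R.Adj b d) :
    IsCoreState c Y (R \ SimpleGraph.edge a b ⊔ star v {a, b}) := by
  have ha : a ∈ Y.erase v := by simp [hY]
  have hb : b ∈ Y.erase v := by simp [hY]
  have hd : d ∈ Y.erase v := by simp [hY]
  simp only [Finset.mem_erase] at ha hb hd
  have hst : IsCoreState c Y (R ⊔ star v {a, b}) :=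
    hR.sup_star hv (fun y hy => by rw [hall y hy, hall v hv]) (by rw [hY]; grind)
      (by rw [Finset.card_pair hab.ne, hall v hv])
  have hle : R \ SimpleGraph.edge a b ⊔ star v {a, b} ≤ R ⊔ star v {a, b} :=
    sup_le_sup_right sdiff_le _
  refine ⟨fun x y h => hst.supp x y (hle h), ?_, hst.up.anti hle⟩
  have key : ∀ y ∈ Y, ∀ p q, p ≠ q → p ∈ Y → q ∈ Y →
      (R \ SimpleGraph.edge a b ⊔ star v {a, b}).Adj y p →
      (R \ SimpleGraph.edge a b ⊔ star v {a, b}).Adj y q →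
      c y ≤ {u | (R \ SimpleGraph.edge a b ⊔ star v {a, b}).Adj y u ∧ c y ≤ c u}.ncard := by
    intro y hy p q hpq hp hq h1 h2
    rw [hall y hy, ← Set.ncard_pair hpq]
    refine Set.ncard_le_ncard ?_ (Set.toFinite _)
    rintro z (rfl | rfl)
    · exact ⟨h1, by rw [Set.ncard_pair hpq, hall _ hp]⟩
    · exact ⟨h2, by rw [Set.ncard_pair hpq, hall _ hq]⟩
  have hab' := hab.ne
  have had' := had.ne
  have hbd' := hbd.ne
  have hadj : ∀ x y, (R \ SimpleGraph.edge a b ⊔ star v {a, b}).Adj x y ↔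
      (R.Adj x y ∧ ¬ ((x = a ∧ y = b ∨ x = b ∧ y = a) ∧ x ≠ y)) ∨
        ((x = v ∧ (y = a ∨ y = b) ∨ y = v ∧ (x = a ∨ x = b)) ∧ x ≠ y) := by
    intro x y
    simp [star_adj, SimpleGraph.edge_adj]
  intro y hy
  have hy' : y = v ∨ y = a ∨ y = b ∨ y = d := by
    by_cases h : y = v
    · exact Or.inl h
    · have : y ∈ Y.erase v := Finset.mem_erase.2 ⟨h, hy⟩
      rw [hY] at this
      simpa [h] using this
  have had2 := had.symm
  have hbd2 := hbd.symm
  rcases hy' with h | h | h | h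
  · exact key y hy a b hab' ha.2 hb.2 (by rw [hadj]; grind) (by rw [hadj]; grind)
  · exact key y hy v d (Ne.symm hd.1) hv hd.2 (by rw [hadj]; grind) (by rw [hadj]; grind)
  · exact key y hy v d (Ne.symm hd.1) hv hd.2 (by rw [hadj]; grind) (by rw [hadj]; grind)
  · exact key y hy a b hab' ha.2 hb.2 (by rw [hadj]; grind) (by rw [hadj]; grind)

theorem edgeSet_fourCycle_sdiff {v a b d : V} (hva : a ≠ v) (hvb : b ≠ v) (hvd : d ≠ v)
    (hR : ∀ x, ¬ R.Adj v x) (hab : R.Adj a b) (had : R.Adj a d) (hbd : b ≠ d) :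
    (R \ SimpleGraph.edge a b ⊔ star v {a, b}).edgeSet \
      (R \ SimpleGraph.edge a d ⊔ star v {a, d}).edgeSet = {s(a, d), s(b, v)} := by
  have hab' := hab.ne
  have had' := had.ne
  ext e
  induction e using Sym2.ind with
  | _ x y =>
    have h1 := hR x
    have h2 := hR y
    have h3 := R.adj_comm x y
    simp only [Set.mem_sdiff, SimpleGraph.mem_edgeSet, SimpleGraph.sup_adj, star_adj,
      SimpleGraph.sdiff_adj, SimpleGraph.edge_adj, Finset.mem_insert, Finset.mem_singleton,
      Set.mem_insert_iff, Set.mem_singleton_iff, Sym2.eq_iff] at *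
    grind

/-- Each side is a four-cycle plus a chord. Deleting the chord leaves two different four-cycles on
the same nodes, and one switch turns one into the other. -/
theorem IsCoreState.reach_swap_triangle {v u w w' : V} (hR : IsCoreState c (Y.erase v) R)
    (hv : v ∈ Y) (htwo : ∀ y, c y ≤ 2) (hall : ∀ y ∈ Y, c y = 2) (hY : Y.erase v = {u, w, w'})
    (huw : R.Adj u w) (huw' : R.Adj u w') (hww' : R.Adj w w') :
    Reach c Y (R ⊔ star v {u, w}) (R ⊔ star v {u, w'}) := by
  have hu : u ∈ Y.erase v := by simp [hY]
  have hw : w ∈ Y.erase v := by simp [hY]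
  have hw' : w' ∈ Y.erase v := by simp [hY]
  have hmin : ∀ y ∈ Y, c v ≤ c y := fun y hy => by rw [hall y hy, hall v hv]
  have s1 := hR.fourCycle hv hall hY huw huw' hww'
  have hY' : Y.erase v = {u, w', w} := by rw [hY]; congr 1; exact Finset.pair_comm _ _
  have s3 := hR.fourCycle hv hall hY' huw' huw hww'.symm
  have s0 : IsCoreState c Y (R ⊔ star v {u, w}) := hR.sup_star hv hmin (by rw [hY]; grind)
    (by rw [Finset.card_pair huw.ne, hall v hv])
  have s4 : IsCoreState c Y (R ⊔ star v {u, w'}) := hR.sup_star hv hmin (by rw [hY]; grind)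
    (by rw [Finset.card_pair huw'.ne, hall v hv])
  have hRv : ∀ x, ¬ R.Adj v x := fun x hx => Finset.notMem_erase v Y (hR.supp v x hx)
  simp only [Finset.mem_erase] at hu hw hw'
  refine (Reach.of_le s1 s0 (sup_le_sup_right sdiff_le _)).symm.trans
    (Reach.trans (.single ⟨s1, s3, ?_⟩) (Reach.of_le s3 s4 (sup_le_sup_right sdiff_le _)))
  rw [edgeSet_fourCycle_sdiff hu.1 hw.1 hw'.1 hRv huw huw' hww'.ne,
    edgeSet_fourCycle_sdiff hu.1 hw'.1 hw.1 hRv huw' huw hww'.ne']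
  exact .switch u w' w v htwo (hall _ hu.2) (hall _ hw'.2) (hall _ hw.2) (hall _ hv) huw.ne hw'.1

/-- One leaf of a star can be exchanged, on top of a suitable state on the other nodes. -/
theorem IsCoreState.exists_reach_swap {v w w' t : V} {A : Finset V} (hG : IsCoreState c Y G)
    (hv : v ∈ Y) (hmin : ∀ u ∈ Y, c v ≤ c u) (hcard : c v + 2 ≤ Y.card)
    (ht : t ∈ Y) (htop : ∀ y, c y ≤ c t) (htwo : 2 ≤ c t)
    (hA : A ⊆ Y.erase v) (hc : A.card = c v) (hw : w ∈ A) (hw' : w' ∈ Y.erase v) (hwA : w' ∉ A) :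
    ∃ R, IsCoreState c (Y.erase v) R ∧
      Reach c Y (R ⊔ star v A) (R ⊔ star v (insert w' (A.erase w))) := by
  obtain ⟨R, hR⟩ := (hG.roomy_erase hv hmin hcard).exists_isCoreState
  by_cases hlt : c v < max (c w) (c w')
  · exact ⟨R, hR, hR.reach_swap_of_lt hv hmin hA hc hw hw' hwA hlt⟩
  -- Both leaves have the value of `v`. A node `h` of larger value serves as a stopover, since
  -- exchanges with `h` are single shifts.
  by_cases hex : ∃ h ∈ Y, c v < c h
  · obtain ⟨h, hhY, hh⟩ := hex
    have hhv : h ∈ Y.erase v := Finset.mem_erase.2 ⟨by rintro rfl; omega, hhY⟩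
    rw [lt_max_iff, not_or] at hlt
    have hhw : h ≠ w := by rintro rfl; exact hlt.1 hh
    have hhw' : h ≠ w' := by rintro rfl; exact hlt.2 hh
    refine ⟨R, hR, ?_⟩
    by_cases hhA : h ∈ A
    · have h1 := hR.reach_swap_of_lt hv hmin hA hc hhA hw' hwA (lt_max_of_lt_left hh)
      have h2 := hR.reach_swap_of_lt (w := w) (w' := h) hv hmin
        (insert_erase_subset (w := h) hA hw')
        (by rw [card_insert_erase hhA hwA, hc]) (by grind) hhv (by grind) (lt_max_of_lt_right hh)
      have : insert h ((insert w' (A.erase h)).erase w) = insert w' (A.erase w) := by grind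
      rw [this] at h2
      exact h1.trans h2
    · have h1 := hR.reach_swap_of_lt hv hmin hA hc hw hhv hhA (lt_max_of_lt_right hh)
      have h2 := hR.reach_swap_of_lt (w := h) (w' := w') hv hmin
        (insert_erase_subset (w := w) hA hhv)
        (by rw [card_insert_erase hw hhA, hc]) (by grind) hw' (by grind) (lt_max_of_lt_left hh)
      have : insert w' ((insert h (A.erase w)).erase h) = insert w' (A.erase w) := by grind
      rw [this] at h2
      exact h1.trans h2
  have hall : ∀ y ∈ Y, c y = c v := fun y hy =>
    le_antisymm (by by_contra! h; exact hex ⟨y, hy, h⟩) (hmin y hy)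
  have hk := hall t ht
  -- All values on `Y` now equal `c t ≥ 2`, so `v` has a second leaf.
  obtain ⟨u, hu⟩ : (A.erase w).Nonempty := by
    rw [← Finset.card_pos, Finset.card_erase_of_mem hw]; omega
  obtain ⟨huw, huA⟩ := Finset.mem_erase.1 hu
  have huv := hA huA
  have hcu := hall u (Finset.mem_of_mem_erase huv)
  have hmin' : ∀ y ∈ Y.erase v, c u ≤ c y := fun y hy => by
    rw [hcu]; exact hmin y (Finset.mem_of_mem_erase hy)
  have hcard' := Finset.card_erase_of_mem hv
  by_cases hlarge : c v + 3 ≤ Y.card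
  -- With room to spare, the lower state is itself built as a star at `u`: then `u` has degree `c
  -- v`, and any leaf `x` of it has a surplus neighbour, namely `u`.
  · obtain ⟨R', hR'⟩ := (hR.roomy_erase huv hmin' (by omega)).exists_isCoreState
    obtain ⟨B, hB, hBc⟩ := Finset.exists_subset_card_eq (s := (Y.erase v).erase u) (n := c u)
      (by rw [Finset.card_erase_of_mem huv]; omega)
    obtain ⟨x, hx⟩ : B.Nonempty := by rw [← Finset.card_pos]; omega
    have hRs := hR'.sup_star huv hmin' hB hBc
    have hadj := sup_star_adj_center hB hR'.supp
    refine ⟨R' ⊔ star u B, hRs, hRs.reach_swap_of_eq (x := x) hv hall hA hc hw hw' hwA huA huw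
      ((hadj x).2 hx) ?_ (Or.inr ?_)⟩
    · have : {y | (R' ⊔ star u B).Adj u y} = (B : Set V) := by ext y; exact hadj y
      rw [this, Set.ncard_coe_finset]
      omega
    · have h1 := hR'.le_ncard_neighborSet (hB hx)
      rw [hall x (Finset.mem_of_mem_erase (Finset.mem_of_mem_erase (hB hx)))] at h1
      have h2 : u ∉ {y | R'.Adj x y} := fun h =>
        Finset.notMem_erase u _ (hR'.supp_right h)
      refine lt_of_lt_of_le (Nat.lt_of_lt_of_le (Nat.lt_succ_of_le h1)
        (Set.ncard_insert_of_notMem h2 (Set.toFinite _)).ge)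
        (Set.ncard_le_ncard ?_ (Set.toFinite _))
      rintro y (rfl | hy)
      · exact ((hadj x).2 hx).symm
      · exact Or.inl hy
  -- Now `Y` has exactly `c v + 2` nodes, so `R` is complete. A third leaf, present once `c v ≥ 3`,
  -- can play the part of `x`.
  have hcompl : ∀ a ∈ Y.erase v, ∀ b ∈ Y.erase v, a ≠ b → R.Adj a b := fun a ha b hb hne =>
    hR.adj_of_card_le (v := u) hmin' (by omega) ha hb hne
  by_cases hthree : 3 ≤ c v
  · obtain ⟨x, hx⟩ : ((A.erase w).erase u).Nonempty := by
      rw [← Finset.card_pos, Finset.card_erase_of_mem hu, Finset.card_erase_of_mem hw]; omega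
    obtain ⟨hxu, hxA⟩ := Finset.mem_erase.1 hx
    have hdeg := hR.ncard_neighborSet_lt huv
    exact ⟨R, hR, hR.reach_swap_of_eq hv hall hA hc hw hw' hwA huA huw
      (hcompl u huv x (hA (Finset.mem_of_mem_erase hxA)) hxu.symm) (by omega) (Or.inl hxA)⟩
  -- The exceptional case: a triangle `u w w'` and the node `v` joined to two of its corners.
  · have hk2 : c v = 2 := by omega
    have hAeq : {u, w} = A := Finset.eq_of_subset_of_card_le (by grind)
      (by rw [Finset.card_pair huw]; omega)
    have huw' : u ≠ w' := by rintro rfl; exact hwA huA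
    have hww' : w ≠ w' := by rintro rfl; exact hwA hw
    have hYeq : {u, w, w'} = Y.erase v := Finset.eq_of_subset_of_card_le
      (by have := hA hw; grind) (by rw [Finset.card_eq_three.2 ⟨u, w, w', huw, huw', hww', rfl⟩]; omega)
    have hA' : insert w' (A.erase w) = {u, w'} := by rw [← hAeq]; grind
    refine ⟨R, hR, ?_⟩
    rw [hA', ← hAeq]
    exact hR.reach_swap_triangle hv (fun y => by have := htop y; omega)
      (fun y hy => by rw [hall y hy, hk2]) hYeq.symm (hcompl u huv w (hA hw) huw)
      (hcompl u huv w' hw' huw') (hcompl w (hA hw) w' hw' hww')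

/-! ### Connectivity by induction on the node set -/

/-- Each exchange brings `A` closer to `B`. It may demand its own lower state `S`, which `hreach`
installs beforehand under the unchanged star. -/
theorem IsCoreState.reach_sup_star {v t : V} {R' : SimpleGraph V} {A B : Finset V}
    (hG : IsCoreState c Y G)
    (hv : v ∈ Y) (hmin : ∀ u ∈ Y, c v ≤ c u) (hcard : c v + 2 ≤ Y.card)
    (ht : t ∈ Y) (htop : ∀ y, c y ≤ c t) (htwo : 2 ≤ c t)
    (hreach : ∀ S S', IsCoreState c (Y.erase v) S → IsCoreState c (Y.erase v) S' →
      Reach c (Y.erase v) S S')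
    (hR : IsCoreState c (Y.erase v) R) (hR' : IsCoreState c (Y.erase v) R')
    (hA : A ⊆ Y.erase v) (hAc : A.card = c v) (hB : B ⊆ Y.erase v) (hBc : B.card = c v) :
    Reach c Y (R ⊔ star v A) (R' ⊔ star v B) := by
  induction hd : (A \ B).card generalizing A R with
  | zero =>
    have hAB : A = B := Finset.eq_of_subset_of_card_le
      (Finset.sdiff_eq_empty_iff_subset.1 (Finset.card_eq_zero.1 hd)) (by omega)
    subst hAB
    exact (hreach R R' hR hR').sup_star hv hmin hA hAc
  | succ d ih =>
    have hBA : (B \ A).card = d + 1 := by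
      rw [← hd]
      exact (Finset.card_sdiff_comm (by omega)).symm
    obtain ⟨w, hw⟩ := Finset.card_pos.1 (by omega : 0 < (A \ B).card)
    obtain ⟨w', hw'⟩ := Finset.card_pos.1 (by omega : 0 < (B \ A).card)
    rw [Finset.mem_sdiff] at hw hw'
    obtain ⟨S, hS, hswap⟩ := hG.exists_reach_swap hv hmin hcard ht htop htwo hA hAc hw.1
      (hB hw'.1) hw'.2
    refine ((hreach R S hR hS).sup_star hv hmin hA hAc).trans (hswap.trans (ih hS
      (insert_erase_subset hA (hB hw'.1)) (by rw [card_insert_erase hw.1 hw'.2, hAc]) ?_))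
    have : insert w' (A.erase w) \ B = (A \ B).erase w := by grind
    rw [this, Finset.card_erase_of_mem (Finset.mem_sdiff.2 hw)]
    omega

/-- Any two states are connected by moves if the largest value is at least `2`. -/
theorem IsCoreState.reach {t : V} (hG : IsCoreState c Y G) (hH : IsCoreState c Y H)
    (ht : t ∈ Y) (htop : ∀ y, c y ≤ c t) (htwo : 2 ≤ c t) : Reach c Y G H := by
  induction hn : Y.card generalizing Y G H t with
  | zero => simp [Finset.card_eq_zero.1 hn] at ht
  | succ n ih =>
    obtain ⟨v, hv, hmin, hdeg⟩ := hG.exists_min ⟨t, ht⟩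
    obtain ⟨u, hu, hminu, hdegu⟩ := hH.exists_min ⟨t, ht⟩
    have hvu : c v = c u := le_antisymm (hmin u hu) (hminu v hv)
    by_cases hcard : Y.card ≤ c v + 1
    · rw [hG.eq_of_card_le hH hmin hcard]
      exact .refl
    have hcardv : c v + 2 ≤ Y.card := by omega
    have hcardu : c u + 2 ≤ Y.card := by omega
    have hreach : ∀ x ∈ Y, (∀ y ∈ Y, c x ≤ c y) → ∀ S S', IsCoreState c (Y.erase x) S →
        IsCoreState c (Y.erase x) S' → Reach c (Y.erase x) S S' := by
      intro x hx hxmin S S' hS hS'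
      have hc := Finset.card_erase_of_mem hx
      -- If the top node itself is removed, its value is also the minimum, so any remaining node can
      -- replace it.
      by_cases hxt : x = t
      · subst hxt
        obtain ⟨s, hs⟩ : (Y.erase x).Nonempty := by rw [← Finset.card_pos]; omega
        have hsx : c x ≤ c s := hxmin s (Finset.mem_of_mem_erase hs)
        exact ih hS hS' hs (fun y => (htop y).trans hsx) (htwo.trans hsx) (by omega)
      · exact ih hS hS' (Finset.mem_erase.2 ⟨Ne.symm hxt, ht⟩) htop htwo (by omega)
    obtain ⟨R, A, hR, hA, hAc, hGR⟩ := hG.exists_reach_sup_star hv hmin hcardv hdeg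
    obtain ⟨S, B, hS, hB, hBc, hHS⟩ := hH.exists_reach_sup_star hu hminu hcardu hdegu
    by_cases huv : u = v
    · subst huv
      exact hGR.trans ((hG.reach_sup_star hu hminu hcardu ht htop htwo (hreach u hu hminu)
        hR hS hA hAc hB hBc).trans hHS.symm)
    have huv' : u ∈ Y.erase v := Finset.mem_erase.2 ⟨huv, hu⟩
    have hminu' : ∀ y ∈ Y.erase v, c u ≤ c y := fun y hy => hminu y (Finset.mem_of_mem_erase hy)
    have hc := Finset.card_erase_of_mem hv
    -- The intermediate state has a star at `v` whose leaves avoid `u`, so the degree of `u` is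
    -- decided by the lower state `R'`. Then `u` can be split off as well.
    obtain ⟨A', hA', hA'c⟩ := Finset.exists_subset_card_eq (s := (Y.erase v).erase u) (n := c v)
      (by rw [Finset.card_erase_of_mem huv']; omega)
    have hA'v : A' ⊆ Y.erase v := hA'.trans (Finset.erase_subset _ _)
    obtain ⟨R', hR', hdegR'⟩ : ∃ R', IsCoreState c (Y.erase v) R' ∧
        {y | R'.Adj u y}.ncard ≤ c u := by
      -- If `Y.erase v` is this small, the degree bound at `u` holds automatically.
      by_cases hle : (Y.erase v).card ≤ c u + 1
      · exact ⟨R, hR, by have := hR.ncard_neighborSet_lt huv'; omega⟩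
      · obtain ⟨R', hR'⟩ := (hR.roomy_erase huv' hminu' (by omega)).exists_isCoreState
        refine ⟨_, hR'.sup_star huv' hminu' hA' (by omega), ?_⟩
        have : {y | (R' ⊔ star u A').Adj u y} = (A' : Set V) := by
          ext y; exact sup_star_adj_center hA' hR'.supp y
        rw [this, Set.ncard_coe_finset]
        omega
    have hK := hR'.sup_star hv hmin hA'v hA'c
    have hdegK : {y | (R' ⊔ star v A').Adj u y}.ncard ≤ c u := by
      refine (Set.ncard_le_ncard ?_ (Set.toFinite _)).trans hdegR'
      rintro y (hy | ⟨⟨h, -⟩ | ⟨-, h⟩, -⟩)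
      · exact hy
      · exact absurd h huv
      · exact absurd (hA' h) (Finset.notMem_erase _ _)
    obtain ⟨S', B', hS', hB', hB'c, hKS⟩ := hK.exists_reach_sup_star hu hminu hcardu hdegK
    exact hGR.trans ((hG.reach_sup_star hv hmin hcardv ht htop htwo (hreach v hv hmin)
      hR hR' hA hAc hA'v hA'c).trans (hKS.trans ((hG.reach_sup_star hu hminu hcardu ht htop htwo
        (hreach u hu hminu) hS' hS hB' hB'c hB hBc).trans hHS.symm)))

end CoreWalk

/-! ### Convergence of lazy doubly stochastic chains -/

namespace CoreWalk

open Filter in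
/-- A lazy irreducible doubly stochastic chain converges to the uniform distribution. -/
theorem tendsto_pow_apply_of_doublyStochastic {ι : Type*} [Fintype ι] [DecidableEq ι]
    {P : Matrix ι ι ℝ} (hP : P ∈ doublyStochastic ℝ ι) (hdiag : ∀ i, 0 < P i i)
    (hconn : ∀ i j, Relation.ReflTransGen (fun i j => 0 < P i j) i j) (i j : ι) :
    Tendsto (fun t : ℕ => (P ^ t) i j) atTop (nhds (1 / (Fintype.card ι : ℝ))) := by
  have hpow : ∀ t, P ^ t ∈ doublyStochastic ℝ ι := fun t => pow_mem hP t
  have hnn : ∀ t i j, 0 ≤ (P ^ t) i j := fun t =>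
    (mem_doublyStochastic_iff_sum.1 (hpow t)).1
  have hge : ∀ t i j k, (P ^ t) i j * P j k ≤ (P ^ (t + 1)) i k := by
    intro t i j k
    rw [pow_succ, Matrix.mul_apply]
    exact Finset.single_le_sum (f := fun x => (P ^ t) i x * P x k)
      (fun x _ => mul_nonneg (hnn t i x) ((mem_doublyStochastic_iff_sum.1 hP).1 x k))
      (Finset.mem_univ j)
  -- Positive diagonal entries keep a pair reachable at all later times, so a single power `M` is
  -- positive everywhere.
  have hev : ∀ i j, ∃ N, ∀ t ≥ N, 0 < (P ^ t) i j := by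
    intro i j
    induction hconn i j with
    | refl =>
      refine ⟨0, fun t _ => ?_⟩
      induction t with
      | zero => simp
      | succ t ih => exact (mul_pos (ih (Nat.zero_le _)) (hdiag i)).trans_le (hge t i i i)
    | @tail j k _ hjk ih =>
      obtain ⟨N, hN⟩ := ih
      refine ⟨N + 1, fun t ht => ?_⟩
      obtain ⟨s, rfl⟩ : ∃ s, t = s + 1 := ⟨t - 1, by omega⟩
      exact (mul_pos (hN s (by omega)) hjk).trans_le (hge s i j k)
  choose N hN using hev
  obtain ⟨M, hM⟩ : ∃ M, ∀ i j, 0 < (P ^ M) i j :=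
    ⟨Finset.univ.sup fun p : ι × ι => N p.1 p.2, fun i j => hN i j _
      (Finset.le_sup (f := fun p : ι × ι => N p.1 p.2) (Finset.mem_univ (i, j)))⟩
  obtain ⟨⟨i₀, j₀⟩, -, hmin⟩ := Finset.exists_min_image Finset.univ
    (fun p : ι × ι => (P ^ M) p.1 p.2) ⟨(i, j), Finset.mem_univ _⟩
  set ε := (P ^ M) i₀ j₀ with hε
  have hεpos : 0 < ε := hM i₀ j₀
  have hn : (0 : ℝ) < Fintype.card ι := by
    exact_mod_cast Fintype.card_pos_iff.2 ⟨i⟩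
  set a : ℕ → ℝ := fun t => ∑ i, |(P ^ t) i j - 1 / (Fintype.card ι : ℝ)| with ha
  -- The deviations in column `j` sum to zero, so `δ` may be subtracted from every entry of `P ^ s`
  -- for free; the column sums drop to `1 - card ι * δ`. Taking `δ = 0` gives monotonicity, `δ = ε`
  -- a strict contraction.
  have hcontr : ∀ s t δ, (∀ i k, δ ≤ (P ^ s) i k) →
      a (s + t) ≤ (1 - Fintype.card ι * δ) * a t := by
    intro s t δ hδ
    have hs := mem_doublyStochastic_iff_sum.1 (hpow s)
    have ht := mem_doublyStochastic_iff_sum.1 (hpow t)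
    have hzero : ∑ k, ((P ^ t) k j - 1 / (Fintype.card ι : ℝ)) = 0 := by
      rw [Finset.sum_sub_distrib, ht.2.2 j]
      simp [hn.ne']
    have hrow : ∀ i, (P ^ (s + t)) i j - 1 / (Fintype.card ι : ℝ) =
        ∑ k, ((P ^ s) i k - δ) * ((P ^ t) k j - 1 / (Fintype.card ι : ℝ)) := by
      intro i
      have : ∀ k, ((P ^ s) i k - δ) * ((P ^ t) k j - 1 / (Fintype.card ι : ℝ)) =
          (P ^ s) i k * (P ^ t) k j - (P ^ s) i k * (1 / (Fintype.card ι : ℝ)) -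
            δ * ((P ^ t) k j - 1 / (Fintype.card ι : ℝ)) := fun k => by ring
      simp_rw [this]
      rw [Finset.sum_sub_distrib, Finset.sum_sub_distrib, ← Finset.mul_sum, hzero,
        ← Finset.sum_mul, hs.2.1 i, pow_add, Matrix.mul_apply]
      ring
    calc a (s + t) = ∑ i, |∑ k, ((P ^ s) i k - δ) *
            ((P ^ t) k j - 1 / (Fintype.card ι : ℝ))| := by
          simp only [ha, hrow]
      _ ≤ ∑ i, ∑ k, ((P ^ s) i k - δ) * |(P ^ t) k j - 1 / (Fintype.card ι : ℝ)| := by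
          refine Finset.sum_le_sum fun i _ => (Finset.abs_sum_le_sum_abs _ _).trans
            (Finset.sum_le_sum fun k _ => ?_)
          rw [abs_mul, abs_of_nonneg (sub_nonneg.2 (hδ i k))]
      _ = (1 - Fintype.card ι * δ) * a t := by
          rw [Finset.sum_comm, ha, Finset.mul_sum]
          refine Finset.sum_congr rfl fun k _ => ?_
          rw [← Finset.sum_mul, Finset.sum_sub_distrib, hs.2.2 k]
          simp
  have hanti : Antitone a := antitone_nat_of_succ_le fun t => by
    have := hcontr 1 t 0 (fun i k => hnn 1 i k)
    rw [add_comm 1 t] at this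
    linarith
  have hnonneg : ∀ t, 0 ≤ a t := fun t => Finset.sum_nonneg fun _ _ => abs_nonneg _
  have hlim := tendsto_atTop_ciInf hanti ⟨0, by rintro _ ⟨t, rfl⟩; exact hnonneg t⟩
  set l := ⨅ t, a t
  have hl0 : 0 ≤ l := ge_of_tendsto' hlim hnonneg
  have hl : l ≤ (1 - Fintype.card ι * ε) * l := by
    refine le_of_tendsto_of_tendsto' ((tendsto_add_atTop_iff_nat M).2 hlim)
      (hlim.const_mul _) fun t => ?_
    rw [add_comm t M]
    exact hcontr M t ε fun i k => hmin (i, k) (Finset.mem_univ _)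
  have hl' : l = 0 := by nlinarith [mul_pos hn hεpos]
  rw [hl'] at hlim
  rw [tendsto_iff_norm_sub_tendsto_zero]
  refine squeeze_zero (fun _ => norm_nonneg _) (fun t => ?_) hlim
  exact Finset.single_le_sum (f := fun i => |(P ^ t) i j - 1 / (Fintype.card ι : ℝ)|)
    (fun _ _ => abs_nonneg _) (Finset.mem_univ i)

/-! ### Validity, preservation and reversal of moves -/

section Moves

variable {V : Type*} {G : SimpleGraph V} {m : Move V}

theorem Move.apply_adj {a b : V} :
    (m.apply G).Adj a b ↔ (G.Adj a b ∧ s(a, b) ∉ m.1 ∨ s(a, b) ∈ m.2) ∧ a ≠ b := by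
  simp only [Move.apply, SimpleGraph.fromEdgeSet_adj, Set.mem_union, Set.mem_sdiff,
    SimpleGraph.mem_edgeSet]

/-- The move deletes edges of `G` and inserts non-edges of `G`. -/
def Move.IsValid (m : Move V) (G : SimpleGraph V) : Prop :=
  m.1 ⊆ G.edgeSet ∧ ∀ e ∈ m.2, ¬ e.IsDiag ∧ e ∉ G.edgeSet

theorem CoreOrSwitchMove.isValid (h : CoreOrSwitchMove G m) : m.IsValid G := by
  have hpair : ∀ {e f : Sym2 V}, e ∈ G.edgeSet → f ∈ G.edgeSet → {e, f} ⊆ G.edgeSet := by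
    rintro e f he hf _ (rfl | rfl) <;> assumption
  have hsingle : ∀ {a b : V}, a ≠ b → ¬ G.Adj a b →
      ∀ e ∈ ({s(a, b)} : Set (Sym2 V)), ¬ e.IsDiag ∧ e ∉ G.edgeSet := by
    rintro a b hne hab _ rfl
    exact ⟨by simpa using hne, hab⟩
  have hpair' : ∀ {a b a' b' : V}, a ≠ b → ¬ G.Adj a b → a' ≠ b' → ¬ G.Adj a' b' →
      ∀ e ∈ ({s(a, b), s(a', b')} : Set (Sym2 V)), ¬ e.IsDiag ∧ e ∉ G.edgeSet := by
    rintro a b a' b' hne hab hne' hab' _ (rfl | rfl)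
    · exact ⟨by simpa using hne, hab⟩
    · exact ⟨by simpa using hne', hab'⟩
  rcases h with h | h
  · cases h with
    | add i j hne hij hp => exact ⟨by simp, hsingle hne hij⟩
    | delete i j hij hp => exact ⟨by simpa using hij, by simp⟩
    | moveEndpoint h i j hc hhj hij =>
      exact ⟨by simpa using hhj, hsingle (by rintro rfl; simp at hc) hij⟩
    | coreCollapse h i j hc hc' hne hhi hhj hij hp => exact ⟨hpair hhi hhj, hsingle hne hij⟩
    | coreExpand h i j hc hc' hij hhi hhj hp =>
      exact ⟨by simpa using hij, hpair' (by rintro rfl; omega) hhi (by rintro rfl; omega) hhj⟩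
    | halfCollapse h i j hc hc' hne hhi hij hp => exact ⟨by simpa using hhi, hsingle hne hij⟩
    | halfExpand h i j hc hc' hij hhi hp =>
      exact ⟨by simpa using hij, hsingle (by rintro rfl; omega) hhi⟩
  · obtain ⟨h, i, j, l, -, -, -, -, hne, hne', hhi, hjl, hhj, hil, -⟩ := h
    exact ⟨hpair hhi hjl, hpair' hne hhj hne' hil⟩

theorem Move.IsValid.mem_edgeSet_apply (h : m.IsValid G) {e : Sym2 V} (he : e ∈ m.2) :
    e ∈ (m.apply G).edgeSet := by
  induction e using Sym2.ind with
  | _ a b => exact Move.apply_adj.2 ⟨Or.inr he, by simpa using (h.2 _ he).1⟩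

theorem Move.IsValid.notMem_edgeSet_apply (h : m.IsValid G) {e : Sym2 V} (he : e ∈ m.1) :
    e ∉ (m.apply G).edgeSet := by
  induction e using Sym2.ind with
  | _ a b =>
    intro hab
    rcases (Move.apply_adj.1 hab).1 with h' | h'
    · exact h'.2 he
    · exact (h.2 _ h').2 (h.1 he)

theorem Move.IsValid.swap_apply (h : m.IsValid G) : Move.apply m.swap (m.apply G) = G := by
  ext a b
  rw [Move.apply_adj, Move.apply_adj]
  have h1 := @h.1 s(a, b)
  have h2 := h.2 s(a, b)
  have h3 := @SimpleGraph.Adj.ne _ G a b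
  simp only [SimpleGraph.mem_edgeSet, Prod.fst_swap, Prod.snd_swap] at *
  grind

theorem apply_sdiff (G H : SimpleGraph V) :
    Move.apply (G.edgeSet \ H.edgeSet, H.edgeSet \ G.edgeSet) G = H := by
  ext a b
  rw [Move.apply_adj]
  have h3 := @SimpleGraph.Adj.ne _ H a b
  simp only [SimpleGraph.mem_edgeSet, Set.mem_sdiff]
  grind

/-- The node `j` trades one neighbour of larger value for another, while `h` and `i` never count `j`
towards their own, larger values. -/
theorem preserves_moveEndpoint [Fintype V] {h i j : V}
    (hc : coreValue G j < min (coreValue G h) (coreValue G i))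
    (hhj : G.Adj h j) (hij : ¬ G.Adj i j) :
    Move.Preserves ({s(h, j)}, {s(i, j)}) G := by
  classical
  obtain ⟨hjh, hji⟩ := lt_min_iff.1 hc
  obtain ⟨c, hcG⟩ : ∃ c : V → ℕ, ∀ v, coreValue G v = c v := ⟨_, fun _ => rfl⟩
  have hG := isCoreState_univ_iff.2 hcG
  rw [hcG, hcG] at hjh hji
  suffices h : IsCoreState c Finset.univ (Move.apply ({s(h, j)}, {s(i, j)}) G) from
    fun v => (isCoreState_univ_iff.1 h v).trans (hcG v).symm
  have hadj : ∀ a b, (Move.apply ({s(h, j)}, {s(i, j)}) G).Adj a b ↔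
      (G.Adj a b ∧ ¬ (a = h ∧ b = j ∨ a = j ∧ b = h) ∨ (a = i ∧ b = j ∨ a = j ∧ b = i)) ∧
        a ≠ b := by
    intro a b
    rw [Move.apply_adj]
    simp only [Set.mem_singleton_iff, Sym2.eq_iff]
  have hijne : i ≠ j := by rintro rfl; omega
  refine ⟨fun _ _ _ => Finset.mem_univ _, ?_, ?_⟩
  · intro u hu
    by_cases huj : u = j
    · subst huj
      have hex := Set.ncard_exchange (s := {x | G.Adj u x ∧ c u ≤ c x}) (a := i) (b := h)
        (fun hx => hij hx.1.symm) ⟨hhj.symm, hjh.le⟩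
      refine (hG.low u hu).trans (hex.symm.le.trans (Set.ncard_le_ncard ?_ (Set.toFinite _)))
      rintro x (rfl | ⟨hx, hxh⟩)
      · exact ⟨(hadj _ _).2 (by grind), hji.le⟩
      · have := hx.1.ne
        simp only [Set.mem_singleton_iff] at hxh
        exact ⟨(hadj _ _).2 (by have := hx.1; grind), hx.2⟩
    · refine (hG.low u hu).trans (Set.ncard_le_ncard ?_ (Set.toFinite _))
      rintro x ⟨hx, hux⟩
      have := hx.ne
      refine ⟨(hadj _ _).2 ?_, hux⟩
      have : ¬ (u = h ∧ x = j) := by rintro ⟨rfl, rfl⟩; omega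
      grind
  · intro T hT _
    obtain ⟨v₀, hv₀, hmin⟩ := T.exists_min_image c hT
    -- Peel only among the nodes of minimum value in `T`: otherwise `i` might be chosen, with `j ∈
    -- T` as an additional counted neighbour.
    obtain ⟨w, hw, hle⟩ := hG.up (T.filter fun u => c u = c v₀) ⟨v₀, by simp [hv₀]⟩
      (Finset.subset_univ _)
    simp only [Finset.mem_filter] at hw hle
    refine ⟨w, hw.1, ?_⟩
    have hT' : ∀ x, x ∈ T ∨ c w < c x → (x ∈ T ∧ c x = c v₀) ∨ c w < c x := by
      rintro x (hx | hx)
      · have := hmin x hx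
        by_cases h : c x = c v₀
        · exact Or.inl ⟨hx, h⟩
        · right; omega
      · exact Or.inr hx
    by_cases hwj : w = j
    · subst hwj
      refine le_trans ?_ ((Set.ncard_exchange
        (s := {u | G.Adj w u ∧ ((u ∈ T ∧ c u = c v₀) ∨ c w < c u)}) (a := i) (b := h) (fun hx => hij hx.1.symm)
        ⟨hhj.symm, Or.inr hjh⟩).le.trans hle)
      refine Set.ncard_le_ncard ?_ (Set.toFinite _)
      rintro x ⟨hx, hx'⟩
      rw [hadj] at hx
      by_cases hxi : x = i
      · exact Or.inl hxi
      · refine Or.inr ⟨⟨by grind, hT' x hx'⟩, ?_⟩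
        rintro (rfl : x = h)
        grind
    · refine (Set.ncard_le_ncard ?_ (Set.toFinite _)).trans hle
      rintro x ⟨hx, hx'⟩
      have hcx : c w ≤ c x := by rcases hT' x hx' with h | h <;> omega
      have : ¬ (w = i ∧ x = j) := by rintro ⟨rfl, rfl⟩; omega
      rw [hadj] at hx
      exact ⟨by grind, hT' x hx'⟩

theorem CoreOrSwitchMove.preserves [Fintype V] (h : CoreOrSwitchMove G m) : m.Preserves G := by
  rcases h with h | h
  · cases h with
    | moveEndpoint h i j hc hhj hij => exact preserves_moveEndpoint hc hhj hij
    | _ => assumption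
  · cases h
    assumption

theorem Move.Preserves.swap (hp : m.Preserves G) (h : m.IsValid G) :
    Move.Preserves m.swap (m.apply G) := by
  intro v
  rw [h.swap_apply, hp v]

theorem CoreMove.swap [Fintype V] (hm : CoreMove G m) : CoreMove (m.apply G) m.swap := by
  have hv := CoreOrSwitchMove.isValid (Or.inl hm)
  have hp := CoreOrSwitchMove.preserves (Or.inl hm)
  have hp' := hp.swap hv
  cases hm with
  | add i j hne hij _ => exact .delete i j (hv.mem_edgeSet_apply rfl) hp'
  | delete i j hij _ => exact .add i j hij.ne (hv.notMem_edgeSet_apply (e := s(i, j)) rfl) hp'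
  | moveEndpoint h i j hc hhj hij =>
    exact .moveEndpoint i h j (by rwa [hp, hp, hp, min_comm]) (hv.mem_edgeSet_apply rfl)
      (hv.notMem_edgeSet_apply (e := s(h, j)) rfl)
  | coreCollapse h i j hc hc' hne hhi hhj hij _ =>
    exact .coreExpand h i j (by rwa [hp, hp]) (by rwa [hp, hp]) (hv.mem_edgeSet_apply rfl)
      (hv.notMem_edgeSet_apply (e := s(h, i)) (Or.inl rfl))
      (hv.notMem_edgeSet_apply (e := s(h, j)) (Or.inr rfl)) hp'
  | coreExpand h i j hc hc' hij hhi hhj _ =>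
    exact .coreCollapse h i j (by rwa [hp, hp]) (by rwa [hp, hp]) hij.ne
      (hv.mem_edgeSet_apply (Or.inl rfl)) (hv.mem_edgeSet_apply (Or.inr rfl))
      (hv.notMem_edgeSet_apply (e := s(i, j)) rfl) hp'
  | halfCollapse h i j hc hc' hne hhi hij _ =>
    exact .halfExpand h i j (by rwa [hp, hp]) (by rwa [hp, hp]) (hv.mem_edgeSet_apply rfl)
      (hv.notMem_edgeSet_apply (e := s(h, i)) rfl) hp'
  | halfExpand h i j hc hc' hij hhi _ =>
    exact .halfCollapse h i j (by rwa [hp, hp]) (by rwa [hp, hp]) hij.ne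
      (hv.mem_edgeSet_apply rfl) (hv.notMem_edgeSet_apply (e := s(i, j)) rfl) hp'

theorem TopSwitch.swap [Fintype V] (hm : TopSwitch G m) : TopSwitch (m.apply G) m.swap := by
  have hv := CoreOrSwitchMove.isValid (Or.inr hm)
  have hp := CoreOrSwitchMove.preserves (Or.inr hm)
  have hp' := hp.swap hv
  have htop : ∀ v, IsTop G v → IsTop (m.apply G) v := fun v hv w => by
    rw [hp, hp]; exact hv w
  obtain ⟨h, i, j, l, th, ti, tj, tl, hne, hne', hhi, hjl, hhj, hil, -⟩ := hm
  exact .mk h j i l (htop h th) (htop j tj) (htop i ti) (htop l tl) hhi.ne hjl.ne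
    (hv.mem_edgeSet_apply (Or.inl rfl)) (hv.mem_edgeSet_apply (Or.inr rfl))
    (hv.notMem_edgeSet_apply (e := s(h, i)) (Or.inl rfl))
    (hv.notMem_edgeSet_apply (e := s(j, l)) (Or.inr rfl)) hp'

/-- A shift is a Move Endpoint, a half collapse or a half expand, according to which of its two ends
have larger value than `v`. -/
theorem EdgeMove.coreMove_or_topSwitch {c : V → ℕ} {D I : Set (Sym2 V)} (hm : EdgeMove c D I)
    (hG : ∀ v, coreValue G v = c v) (hv : Move.IsValid (D, I) G)
    (hp : Move.Preserves (D, I) G) :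
    CoreMove G (D, I) ∨ (TopSwitch G (D, I) ∧ ∀ v, c v ≤ 2) := by
  obtain ⟨hD, hI⟩ := hv
  cases hm with
  | add i j => exact Or.inl (.add i j (by simpa using (hI _ rfl).1) (hI s(i, j) rfl).2 hp)
  | delete i j => exact Or.inl (.delete i j (@hD s(i, j) rfl) hp)
  | shift v a b ha hb hab =>
    have hva : G.Adj v a := @hD s(v, a) rfl
    have hvb : ¬ G.Adj v b := (hI s(v, b) rfl).2
    have hne : v ≠ b := by simpa using (hI s(v, b) rfl).1
    left
    by_cases h1 : c v < c a
    · by_cases h2 : c v < c b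
      · rw [Sym2.eq_swap (a := v) (b := a), Sym2.eq_swap (a := v) (b := b)]
        exact .moveEndpoint a b v (by simp only [hG]; exact lt_min h1 h2) hva.symm
          fun h => hvb h.symm
      · rw [Sym2.eq_swap (a := v) (b := a)] at hp ⊢
        exact .halfCollapse a v b (by simpa only [hG]) (by simp only [hG]; omega) hne hva.symm
          hvb hp
    · have h2 : c v < c b := (lt_max_iff.1 hab).resolve_left h1
      rw [Sym2.eq_swap (a := v) (b := b)] at hp ⊢
      exact .halfExpand b v a (by simpa only [hG]) (by simp only [hG]; omega) hva
        (fun h => hvb h.symm) hp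
  | switch h i j l hc hh hi hj hl hne hne' =>
    have htop : ∀ v, c v = 2 → IsTop G v := fun v hv w => by
      rw [hG, hG, hv]; exact hc w
    exact Or.inr ⟨.mk h i j l (htop h hh) (htop i hi) (htop j hj) (htop l hl) hne hne'
      (@hD s(h, i) (Or.inl rfl)) (@hD s(j, l) (Or.inr rfl)) (hI s(h, j) (Or.inl rfl)).2
      (hI s(i, l) (Or.inr rfl)).2 hp, hc⟩

end Moves

end CoreWalk

/-! ### The random walk on the state space -/

namespace CoreWalk

variable {n : ℕ} {c : Fin n → ℕ} {L : SimpleGraph (Fin n) → Move (Fin n) → Prop}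

/-- Exchanging deleted and inserted edges is a bijection between the moves from `G` to `H` and those
from `H` to `G`. -/
theorem ncard_moves_symm (hval : ∀ G m, L G m → m.IsValid G)
    (hswap : ∀ G m, L G m → L (m.apply G) m.swap) (G H : SimpleGraph (Fin n)) :
    {m | L G m ∧ m.apply G = H}.ncard = {m | L H m ∧ m.apply H = G}.ncard := by
  have key : ∀ G H : SimpleGraph (Fin n),
      Prod.swap '' {m : Move (Fin n) | L G m ∧ m.apply G = H} ⊆
        {m : Move (Fin n) | L H m ∧ m.apply H = G} := by
    rintro G _ _ ⟨m, ⟨hm, rfl⟩, rfl⟩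
    exact ⟨hswap G m hm, (hval G m hm).swap_apply⟩
  have hle : ∀ G H : SimpleGraph (Fin n), {m : Move (Fin n) | L G m ∧ m.apply G = H}.ncard ≤
      {m | L H m ∧ m.apply H = G}.ncard := fun G H => by
    rw [← Set.ncard_image_of_injective _ Prod.swap_injective]
    exact Set.ncard_le_ncard (key G H) (Set.toFinite _)
  exact le_antisymm (hle G H) (hle H G)

theorem sum_ncard_moves (G : StateSpace c)
    (hpres : ∀ m, L G.1 m → ∀ v, coreValue (m.apply G.1) v = c v) :
    ∑ H : StateSpace c, {m | L G.1 m ∧ m.apply G.1 = H.1}.ncard = numMoves L G.1 := by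
  classical
  -- The legal moves are counted by their target state; for illegal moves `G` is a dummy target.
  have hex : ∀ m, ∃ H : StateSpace c, L G.1 m → H.1 = m.apply G.1 := fun m => by
    by_cases hm : L G.1 m
    · exact ⟨⟨m.apply G.1, hpres m hm⟩, fun _ => rfl⟩
    · exact ⟨G, fun h => absurd h hm⟩
  choose f hf using hex
  rw [numMoves, Set.ncard_eq_toFinset_card _ (Set.toFinite _),
    Finset.card_eq_sum_card_fiberwise (f := f) (t := Finset.univ) (fun _ _ => Finset.mem_coe.2
      (Finset.mem_univ _))]
  refine Finset.sum_congr rfl fun H _ => ?_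
  rw [← Set.ncard_coe_finset]
  congr 1
  ext m
  simp only [Finset.coe_filter, Set.Finite.mem_toFinset, Set.mem_ofPred_eq]
  refine and_congr_right fun hm => ?_
  rw [← hf m hm]
  exact Subtype.ext_iff.symm

theorem one_half_le_stay (G : StateSpace c) :
    (1 / 2 : ℝ) ≤ 1 - (numMoves L G.1 : ℝ) / (2 * maxMoves L c) := by
  have h : (numMoves L G.1 : ℝ) ≤ maxMoves L c := by
    exact_mod_cast Finset.le_sup (f := fun G : StateSpace c => numMoves L G.1) (Finset.mem_univ G)
  have : (numMoves L G.1 : ℝ) / (2 * maxMoves L c) ≤ 1 / 2 := by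
    -- This covers `maxMoves L c = 0` too, where the quotient is `0`.
    refine div_le_of_le_mul₀ (by positivity) (by norm_num) ?_
    linarith
  linarith

theorem walk_apply_self_pos (G : StateSpace c) : 0 < walk L c G G := by
  have := one_half_le_stay (L := L) G
  have h : (0 : ℝ) ≤ ({m | L G.1 m ∧ m.apply G.1 = G.1}.ncard : ℝ) / (2 * maxMoves L c) := by
    positivity
  simp only [walk, Matrix.of_apply, if_true]
  linarith

theorem walk_nonneg (G H : StateSpace c) : 0 ≤ walk L c G H := by
  have := one_half_le_stay (L := L) G
  simp only [walk, Matrix.of_apply]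
  refine add_nonneg ?_ (by positivity)
  split_ifs <;> linarith

theorem walk_pos_of_step {G H : StateSpace c} (h : Step L c G H) : 0 < walk L c G H := by
  obtain ⟨m, hm, hmH⟩ := h
  have h1 : 0 < {m | L G.1 m ∧ m.apply G.1 = H.1}.ncard :=
    (Set.ncard_pos (Set.toFinite _)).2 ⟨m, hm, hmH⟩
  have h2 : 0 < maxMoves L c :=
    ((Set.ncard_pos (Set.toFinite _)).2 ⟨m, hm⟩ : 0 < numMoves L G.1).trans_le
      (Finset.le_sup (f := fun G : StateSpace c => numMoves L G.1) (Finset.mem_univ G))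
  have := one_half_le_stay (L := L) G
  simp only [walk, Matrix.of_apply]
  refine add_pos_of_nonneg_of_pos (by split_ifs <;> linarith) ?_
  have : (0 : ℝ) < maxMoves L c := by exact_mod_cast h2
  have : (0 : ℝ) < {m | L G.1 m ∧ m.apply G.1 = H.1}.ncard := by exact_mod_cast h1
  positivity

theorem walk_symm (hval : ∀ G m, L G m → m.IsValid G)
    (hswap : ∀ G m, L G m → L (m.apply G) m.swap) (G H : StateSpace c) :
    walk L c G H = walk L c H G := by
  simp only [walk, Matrix.of_apply]
  rw [ncard_moves_symm hval hswap G.1 H.1]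
  by_cases h : G = H
  · subst h; rfl
  · rw [if_neg h, if_neg (Ne.symm h)]

theorem sum_walk (hpres : ∀ (G : StateSpace c) m, L G.1 m → ∀ v, coreValue (m.apply G.1) v = c v)
    (G : StateSpace c) : ∑ H, walk L c G H = 1 := by
  simp only [walk, Matrix.of_apply]
  rw [Finset.sum_add_distrib, Finset.sum_ite_eq, if_pos (Finset.mem_univ _), ← Finset.sum_div,
    ← Nat.cast_sum, sum_ncard_moves G (hpres G)]
  ring

theorem walk_mem_doublyStochastic
    (hpres : ∀ (G : StateSpace c) m, L G.1 m → ∀ v, coreValue (m.apply G.1) v = c v)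
    (hval : ∀ G m, L G m → m.IsValid G) (hswap : ∀ G m, L G m → L (m.apply G) m.swap) :
    walk L c ∈ doublyStochastic ℝ (StateSpace c) := by
  refine mem_doublyStochastic_iff_sum.2 ⟨walk_nonneg, sum_walk hpres, fun H => ?_⟩
  simp_rw [fun G => walk_symm (c := c) hval hswap G H]
  exact sum_walk hpres H

/-- Switches are demanded only when all values are at most 2, so both move sets are covered. -/
theorem reflTransGen_step (hL : ∀ G m, CoreMove G m → L G m)
    (hL' : (∀ v, c v ≤ 2) → ∀ G m, TopSwitch G m → L G m) {t : Fin n} (htop : ∀ v, c v ≤ c t)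
    (htwo : 2 ≤ c t) (G H : StateSpace c) : Relation.ReflTransGen (Step L c) G H := by
  have key : ∀ K, Reach c Finset.univ G.1 K →
      ∀ hK : ∀ v, coreValue K v = c v, Relation.ReflTransGen (Step L c) G ⟨K, hK⟩ := by
    intro K hK
    induction hK with
    | refl => exact fun _ => .refl
    | @tail K K' _ hlink ih =>
      intro hK'
      obtain ⟨h1, h2, hm⟩ := hlink
      rw [isCoreState_univ_iff] at h1 h2
      refine (ih h1).tail ⟨_, ?_, apply_sdiff K K'⟩
      have hv : Move.IsValid (K.edgeSet \ K'.edgeSet, K'.edgeSet \ K.edgeSet) K :=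
        ⟨Set.sdiff_subset, fun e he => ⟨K'.not_isDiag_of_mem_edgeSet he.1, he.2⟩⟩
      have hp : Move.Preserves (K.edgeSet \ K'.edgeSet, K'.edgeSet \ K.edgeSet) K := fun v => by
        rw [apply_sdiff, h2, h1]
      rcases hm.coreMove_or_topSwitch h1 hv hp with h | ⟨h, hc⟩
      · exact hL _ _ h
      · exact hL' hc _ _ h
  exact key H.1 ((isCoreState_univ_iff.2 G.2).reach (isCoreState_univ_iff.2 H.2)
    (Finset.mem_univ t) htop htwo) H.2

end CoreWalk

theorem mainTheorem2 (n : ℕ) (hn : 0 < n) (c : Fin n → ℕ) (hc : Antitone c)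
    (L : SimpleGraph (Fin n) → CoreWalk.Move (Fin n) → Prop)
    (hL : (2 < c ⟨0, hn⟩ ∧ L = CoreWalk.CoreMove) ∨
      (c ⟨0, hn⟩ = 2 ∧ L = CoreWalk.CoreOrSwitchMove)) :
    -- every legal move preserves all core-values
    (∀ (G : CoreWalk.StateSpace c) (m : CoreWalk.Move (Fin n)), L G.1 m →
      ∀ v, CoreWalk.coreValue (m.apply G.1) v = c v) ∧
    -- every move can be reversed by a move
    (∀ G G' : CoreWalk.StateSpace c, CoreWalk.Step L c G G' → CoreWalk.Step L c G' G) ∧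
    -- any two graphs are connected by a path of moves
    (∀ G G' : CoreWalk.StateSpace c, Relation.ReflTransGen (CoreWalk.Step L c) G G') ∧
    -- the lazy random walk is a Markov chain with uniform stationary distribution
    CoreWalk.walk L c ∈ Matrix.rowStochastic ℝ (CoreWalk.StateSpace c) ∧
    Matrix.vecMul (CoreWalk.uniform c) (CoreWalk.walk L c) = CoreWalk.uniform c ∧
    -- it converges to the uniform distribution from any starting graph
    (∀ G G' : CoreWalk.StateSpace c,
      Filter.Tendsto (fun t : ℕ => (CoreWalk.walk L c ^ t) G G') Filter.atTop
        (nhds (CoreWalk.uniform c G'))) := by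
  have hswitch : ∀ G m, L G m → CoreWalk.CoreOrSwitchMove G m := by
    rcases hL with ⟨-, rfl⟩ | ⟨-, rfl⟩
    · exact fun _ _ h => Or.inl h
    · exact fun _ _ h => h
  have hval : ∀ G m, L G m → m.IsValid G := fun G m h => (hswitch G m h).isValid
  have hswap : ∀ G m, L G m → L (m.apply G) m.swap := by
    rcases hL with ⟨-, rfl⟩ | ⟨-, rfl⟩
    · exact fun _ _ h => h.swap
    · exact fun _ _ h => h.imp CoreWalk.CoreMove.swap CoreWalk.TopSwitch.swap
  have hpres : ∀ (G : CoreWalk.StateSpace c) (m : CoreWalk.Move (Fin n)), L G.1 m →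
      ∀ v, CoreWalk.coreValue (m.apply G.1) v = c v := fun G m h v =>
    ((hswitch _ _ h).preserves v).trans (G.2 v)
  have htop : ∀ v, c v ≤ c ⟨0, hn⟩ := fun v => hc (Nat.zero_le _)
  have htwo : 2 ≤ c ⟨0, hn⟩ := by rcases hL with ⟨h, -⟩ | ⟨h, -⟩ <;> omega
  have hcore : ∀ G m, CoreWalk.CoreMove G m → L G m := by
    rcases hL with ⟨-, rfl⟩ | ⟨-, rfl⟩
    · exact fun _ _ h => h
    · exact fun _ _ h => Or.inl h
  have htopSwitch : (∀ v, c v ≤ 2) → ∀ G m, CoreWalk.TopSwitch G m → L G m := by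
    intro h2
    rcases hL with ⟨h, -⟩ | ⟨-, rfl⟩
    · exact absurd (h2 _) (not_le.2 h)
    · exact fun _ _ h => Or.inr h
  have hconn := CoreWalk.reflTransGen_step hcore htopSwitch htop htwo
  have hds := CoreWalk.walk_mem_doublyStochastic hpres hval hswap
  have hds' := mem_doublyStochastic_iff_sum.1 hds
  refine ⟨hpres, ?_, hconn, Matrix.mem_rowStochastic_iff_sum.2 ⟨hds'.1, hds'.2.1⟩, ?_, ?_⟩
  · rintro G G' ⟨m, hm, hmG⟩
    exact ⟨m.swap, hmG ▸ hswap _ _ hm, by rw [← hmG, (hval _ _ hm).swap_apply]⟩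
  · ext G
    simp only [Matrix.vecMul, dotProduct, CoreWalk.uniform]
    rw [← Finset.mul_sum, hds'.2.2 G, mul_one]
  · exact CoreWalk.tendsto_pow_apply_of_doublyStochastic hds CoreWalk.walk_apply_self_pos
      fun G G' => Relation.ReflTransGen.mono (fun _ _ => CoreWalk.walk_pos_of_step) _ _ (hconn G G')
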